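/- Let $n\ge 1$. Let $\chi:\mathbb{R}\to\mathbb{R}$ be a convex increasing function with $\lim_{t\to-\infty}\chi'(t)=C_0>0$ (where $\chi'$ denotes the right derivative, which exists everywhere), extended by $\chi(-\infty)=-\infty$. Let $\varphi$ be a plurisubharmonic function on an open neighbourhood of the origin $o\in\mathbb{C}^n$ whose Lelong number $\nu(\varphi,o)=\liminf_{z\to o}\varphi(z)/\log|z|$ satisfies $C_0\cdot\nu(\varphi,o)\ge n$. Let $\varphi_A$ be a plurisubharmonic function on $\mathbb{C}^n$ with generalized analytic singularities, i.e. every $x_0\in\mathbb{C}^n$ has a ball $B_r(x_0)$ such that for every complex affine line $L$ the restriction $\varphi_A|_{L\cap B_r(x_0)}$ has analytic singularities: near each point of $L\cap B_r(x_0)$ it can be written as $\frac{c}{2}\log\big(\sum_{k=1}^m|f_k|^2\big)+O(1)$ with $c>0$ and holomorphic functions $f_1,\dots,f_m$ of one variable (here $\log 0=-\infty$, and all $f_k$ may vanish identically). Plurisubharmonic functions take values in $[-\infty,\infty)$ and are not identically $-\infty$ on any connected component of their domain. If $e^{-2\chi\circ\varphi}-e^{-2\varphi_A}$ is integrable on some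 neighbourhood of $o$ (with respect to Lebesgue measure), then $\lim_{t\to-\infty}|\chi(t)-C_0t|$ exists and is finite. -/

import Mathlib

open MeasureTheory Filter Topology Set

noncomputable section

namespace PshSing

/-- `ℂⁿ` with its Euclidean norm and Lebesgue measure. -/
abbrev Cn (n : ℕ) : Type := EuclideanSpace ℂ (Fin n)

/-- The integral `∫ f⁺ - ∫ f⁻` of a function with values in `[-∞, ∞]`. It is used only for
functions that are bounded above on a finite measure space, where `∫ f⁺ < ∞`. -/
def extIntegral {α : Type*} [MeasurableSpace α] (μ : Measure α) (f : α → EReal) : EReal :=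
  ((∫⁻ x, (f x).toENNReal ∂μ : ENNReal) : EReal) - ((∫⁻ x, (-f x).toENNReal ∂μ : ENNReal) : EReal)

/-- Plurisubharmonic functions on a set `U` (meant to be open): values in `[-∞, ∞)`, upper
semicontinuous, satisfying the sub-mean value inequality on every closed complex disc
`{z + ζ w : |ζ| ≤ 1}` contained in `U`, and not identically `-∞` on any connected component
of `U`. -/
structure IsPlurisubharmonicOn {n : ℕ} (φ : Cn n → EReal) (U : Set (Cn n)) : Prop where
  lt_top : ∀ z ∈ U, φ z < ⊤
  usc : UpperSemicontinuousOn φ U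
  submean : ∀ z w : Cn n, (∀ ζ : ℂ, ‖ζ‖ ≤ 1 → z + ζ • w ∈ U) →
    ((2 * Real.pi : ℝ) : EReal) * φ z ≤
      extIntegral (volume.restrict (Ioc (0 : ℝ) (2 * Real.pi)))
        (fun θ => φ (z + Complex.exp (θ * Complex.I) • w))
  ne_bot : ∀ z ∈ U, ∃ w ∈ connectedComponentIn U z, φ w ≠ ⊥

/-- The Lelong number `ν(φ, x) = liminf_{z → x, z ≠ x} φ(z) / log ‖z - x‖`. -/
def lelongNumber {n : ℕ} (φ : Cn n → EReal) (x : Cn n) : EReal :=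
  liminf (fun z => φ z / ((Real.log ‖z - x‖ : ℝ) : EReal)) (𝓝[≠] x)

/-- `u` has analytic singularities on the open set `D` of a complex normed space: near every
point of `D`, `u = (c / 2) log (∑ |f k|²) + O(1)` with `c > 0` and finitely many holomorphic
functions `f k`. Here `log 0 = -∞`, so `u = -∞` on the common zeros of the `f k`. -/
def HasAnalyticSingularitiesOn {F : Type*} [NormedAddCommGroup F] [NormedSpace ℂ F]
    (u : F → EReal) (D : Set F) : Prop :=
  ∀ x ∈ D, ∃ W : Set F, IsOpen W ∧ x ∈ W ∧ W ⊆ D ∧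
    ∃ (c : ℝ) (m : ℕ) (f : Fin m → F → ℂ) (M : ℝ), 0 < c ∧
      (∀ k, DifferentiableOn ℂ (f k) W) ∧
      ∀ y ∈ W,
        ((c / 2 : ℝ) : EReal) * ENNReal.log (∑ k, ‖f k y‖ₑ ^ 2) - (M : EReal) ≤ u y ∧
        u y ≤ ((c / 2 : ℝ) : EReal) * ENNReal.log (∑ k, ‖f k y‖ₑ ^ 2) + (M : EReal)

/-- Generalized analytic singularities on the open set `U`: every `x₀ ∈ U` has a ball
`B_r(x₀) ⊆ U` such that for every complex line `L = {a + ζ v}` the restriction of `φ` to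
`L ∩ B_r(x₀)`, written in the coordinate `ζ`, has analytic singularities. -/
def HasGenAnalyticSingularitiesOn {n : ℕ} (φ : Cn n → EReal) (U : Set (Cn n)) : Prop :=
  ∀ x₀ ∈ U, ∃ r : ℝ, 0 < r ∧ Metric.ball x₀ r ⊆ U ∧
    ∀ a v : Cn n, v ≠ 0 →
      HasAnalyticSingularitiesOn (fun ζ : ℂ => φ (a + ζ • v))
        {ζ : ℂ | a + ζ • v ∈ Metric.ball x₀ r}

/-- Extension of a function `χ : ℝ → ℝ` to `[-∞, ∞]` by `χ(±∞) = ±∞`; this is the continuous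
extension at `-∞` when `χ` is convex with `lim_{t → -∞} χ'(t) > 0`. -/
def extend (χ : ℝ → ℝ) (x : EReal) : EReal :=
  EReal.rec ⊥ (fun t : ℝ => ((χ t : ℝ) : EReal)) ⊤ x

/-- The real number `e^{-2x}` for `x ∈ (-∞, ∞]`. At `x = -∞` the value is `0` by convention; this
happens only on the polar set of a plurisubharmonic function, which is Lebesgue null. -/
def expNegTwo (x : EReal) : ℝ := (EReal.exp (-2 * x)).toReal

end PshSing

end

namespace PshSing

section Convex

variable {χ : ℝ → ℝ} {C₀ : ℝ}

lemma le_rightDeriv_of_tendsto_atBot (hc : ConvexOn ℝ univ χ)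
    (hd : Tendsto (fun t : ℝ => derivWithin χ (Ioi t) t) atBot (𝓝 C₀)) (x : ℝ) :
    C₀ ≤ derivWithin χ (Ioi x) x := by
  have hm := hc.monotoneOn_rightDeriv
  refine le_of_tendsto hd ?_
  filter_upwards [eventually_le_atBot x] with t ht
  exact hm (by simp) (by simp) ht

lemma monotone_sub_mul_of_tendsto_rightDeriv (hc : ConvexOn ℝ univ χ)
    (hd : Tendsto (fun t : ℝ => derivWithin χ (Ioi t) t) atBot (𝓝 C₀)) :
    Monotone (fun t => χ t - C₀ * t) := by
  intro x y hxy
  rcases hxy.eq_or_lt with rfl | hxy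
  · rfl
  have h1 := hc.rightDeriv_le_slope_of_mem_interior (x := x) (y := y) (by simp) (by simp) hxy
  have h2 := le_rightDeriv_of_tendsto_atBot hc hd x
  rw [slope_def_field] at h1
  have h3 := h2.trans h1
  rw [le_div_iff₀ (by linarith)] at h3
  simp only
  linarith

lemma exists_mul_sub_le_of_tendsto_rightDeriv (hc : ConvexOn ℝ univ χ)
    (hd : Tendsto (fun t : ℝ => derivWithin χ (Ioi t) t) atBot (𝓝 C₀)) {A : ℝ} (hA : C₀ < A) :
    ∃ K T : ℝ, ∀ t ≤ T, A * t - K ≤ χ t := by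
  obtain ⟨T, hT⟩ := (hd.eventually (gt_mem_nhds hA)).exists
  refine ⟨A * T - χ T, T, fun t ht => ?_⟩
  rcases ht.eq_or_lt with rfl | ht
  · linarith
  have h1 := hc.slope_le_leftDeriv_of_mem_interior (x := t) (y := T) (by simp) (by simp) ht
  have h2 := hc.leftDeriv_le_rightDeriv_of_mem_interior (x := T) (by simp)
  have h3 := (h1.trans h2).trans hT.le
  rw [slope_def_field, div_le_iff₀ (by linarith)] at h3
  linarith

end Convex

lemma _root_.Monotone.tendsto_atBot_atBot_or_nhds {g : ℝ → ℝ} (hg : Monotone g) :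
    Tendsto g atBot atBot ∨ ∃ l, Tendsto g atBot (𝓝 l) := by
  by_cases h : BddBelow (range g)
  · exact Or.inr ⟨_, tendsto_atBot_ciInf hg h⟩
  · refine Or.inl (tendsto_atBot_atBot_of_monotone hg fun b => ?_)
    simp only [BddBelow, Set.Nonempty, lowerBounds, mem_range, forall_exists_index,
      forall_apply_eq_imp_iff, mem_ofPred_eq, not_exists, not_forall, not_le] at h
    obtain ⟨x, hx⟩ := h b
    exact ⟨x, hx.le⟩

lemma ofReal_add_toENNReal_neg {q : ℝ} {x : EReal} (h : x ≤ q) :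
    ENNReal.ofReal q + (-x).toENNReal =
      ((q : EReal) - x).toENNReal + x.toENNReal + ENNReal.ofReal (-q) := by
  induction x with
  | bot => simp
  | top => simp at h
  | coe x =>
    have h : x ≤ q := by exact_mod_cast h
    rw [← EReal.coe_neg, ← EReal.coe_sub]
    simp only [EReal.real_coe_toENNReal]
    rcases le_total 0 q with hq | hq <;> rcases le_total 0 x with hx | hx
    · rw [ENNReal.ofReal_of_nonpos (neg_nonpos.2 hq), ENNReal.ofReal_of_nonpos (neg_nonpos.2 hx),
        ← ENNReal.ofReal_add (by linarith) hx]
      simp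
    · rw [ENNReal.ofReal_of_nonpos (neg_nonpos.2 hq), ENNReal.ofReal_of_nonpos hx,
        ← ENNReal.ofReal_add hq (by linarith)]
      simp [sub_eq_add_neg]
    · have : x = 0 := le_antisymm (h.trans hq) hx
      have : q = 0 := le_antisymm hq (hx.trans h)
      subst_vars; simp
    · rw [ENNReal.ofReal_of_nonpos hq, ENNReal.ofReal_of_nonpos hx, add_zero,
        ← ENNReal.ofReal_add (by linarith) (by linarith)]
      ring_nf

/-- A function below a real integrable function `q` whose extended integral is at least `c`
satisfies `∫ (q - f) ≤ ∫ q - c`. -/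
lemma lintegral_sub_le_of_le_extIntegral {α : Type*} [MeasurableSpace α] {μ : Measure α}
    {f : α → EReal} {q : α → ℝ} {c : ℝ} (hf : AEMeasurable f μ) (hq : Integrable q μ)
    (hfq : ∀ᵐ x ∂μ, f x ≤ q x) (hc : (c : EReal) ≤ extIntegral μ f) :
    ∫⁻ x, ((q x : EReal) - f x).toENNReal ∂μ ≤ ENNReal.ofReal ((∫ x, q x ∂μ) - c) := by
  have hqm := hq.aemeasurable
  have hsum : ∫⁻ x, ENNReal.ofReal (q x) ∂μ + ∫⁻ x, (-f x).toENNReal ∂μ =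
      ∫⁻ x, ((q x : EReal) - f x).toENNReal ∂μ + ∫⁻ x, (f x).toENNReal ∂μ
        + ∫⁻ x, ENNReal.ofReal (-q x) ∂μ := by
    have hqn : AEMeasurable (fun x => ENNReal.ofReal (-q x)) μ := hqm.neg.ennreal_ofReal
    rw [← lintegral_add_left' hqm.ennreal_ofReal, ← lintegral_add_right' _ hf.ereal_toENNReal,
      ← lintegral_add_right' _ hqn]
    refine lintegral_congr_ae ?_
    filter_upwards [hfq] with x hx
    exact ofReal_add_toENNReal_neg hx
  have hq1 : ∫⁻ x, ENNReal.ofReal (q x) ∂μ ≠ ⊤ := (Integrable.lintegral_lt_top hq).ne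
  have hq2 : ∫⁻ x, ENNReal.ofReal (-q x) ∂μ ≠ ⊤ := (Integrable.lintegral_lt_top hq.neg).ne
  have hint : ∫ x, q x ∂μ = (∫⁻ x, ENNReal.ofReal (q x) ∂μ).toReal
      - (∫⁻ x, ENNReal.ofReal (-q x) ∂μ).toReal :=
    integral_eq_lintegral_pos_part_sub_lintegral_neg_part hq
  have hf1 : ∫⁻ x, (f x).toENNReal ∂μ ≠ ⊤ := by
    refine ne_top_of_le_ne_top hq1 (lintegral_mono_ae ?_)
    filter_upwards [hfq] with x hx
    simpa using EReal.toENNReal_le_toENNReal hx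
  unfold extIntegral at hc
  have hf2 : ∫⁻ x, (-f x).toENNReal ∂μ ≠ ⊤ := by
    intro h
    rw [h] at hc
    simp at hc
  generalize ∫⁻ x, (f x).toENNReal ∂μ = P at *
  generalize ∫⁻ x, (-f x).toENNReal ∂μ = N at *
  generalize ∫⁻ x, ENNReal.ofReal (q x) ∂μ = Q at *
  generalize ∫⁻ x, ENNReal.ofReal (-q x) ∂μ = Q' at *
  generalize ∫⁻ x, ((q x : EReal) - f x).toENNReal ∂μ = D at *
  have hD : D ≠ ⊤ := by
    rintro rfl
    exact (ENNReal.add_ne_top.2 ⟨hq1, hf2⟩) (by simp [hsum])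
  lift P to NNReal using hf1
  lift N to NNReal using hf2
  lift Q to NNReal using hq1
  lift Q' to NNReal using hq2
  lift D to NNReal using hD
  have hsum' : (Q : ℝ) + N = D + P + Q' := by exact_mod_cast hsum
  have hc' : c ≤ (P : ℝ) - N := by
    rw [← EReal.coe_le_coe_iff, EReal.coe_sub]
    exact hc
  rw [hint]
  refine ENNReal.le_ofReal_iff_toReal_le (by simp) ?_ |>.2 ?_
  · simp; linarith
  · simp; linarith

section Submean

open Classical in
lemma measurable_piecewise_top {E : Type*} [TopologicalSpace E] [MeasurableSpace E]
    [BorelSpace E] {u : E → EReal} {U : Set E} (hU : IsOpen U) (h : UpperSemicontinuousOn u U) :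
    Measurable (U.piecewise u (fun _ => ⊤)) := by
  refine measurable_of_Iio fun c => ?_
  obtain ⟨V, hV, hUV⟩ := upperSemicontinuousOn_iff_preimage_Iio.1 h c
  have : U.piecewise u (fun _ => ⊤) ⁻¹' Iio c = U ∩ V := by
    rw [← hUV]
    ext x
    by_cases hx : x ∈ U <;> simp [hx]
  rw [this]
  exact (hU.inter hV).measurableSet

variable {E : Type*} [NormedAddCommGroup E] [NormedSpace ℂ E]

/-- Upper semicontinuous functions `U → [-∞, ∞)` with the sub-mean value inequality on complex
discs. -/
structure SubmeanOn (u : E → EReal) (U : Set E) : Prop where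
  lt_top : ∀ z ∈ U, u z < ⊤
  usc : UpperSemicontinuousOn u U
  submean : ∀ z w : E, (∀ ζ : ℂ, ‖ζ‖ ≤ 1 → z + ζ • w ∈ U) →
    ((2 * Real.pi : ℝ) : EReal) * u z ≤
      extIntegral (volume.restrict (Ioc (0 : ℝ) (2 * Real.pi)))
        (fun θ => u (z + Complex.exp (θ * Complex.I) • w))

lemma IsPlurisubharmonicOn.submeanOn {n : ℕ} {φ : Cn n → EReal} {U : Set (Cn n)}
    (h : IsPlurisubharmonicOn φ U) : SubmeanOn φ U :=
  ⟨h.lt_top, h.usc, h.submean⟩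

lemma SubmeanOn.comp_smul {u : E → EReal} {U : Set E} (h : SubmeanOn u U) (w : E) :
    SubmeanOn (fun ζ : ℂ => u (ζ • w)) {ζ : ℂ | ζ • w ∈ U} where
  lt_top z hz := h.lt_top _ hz
  usc := by
    have hc : Continuous (fun ζ : ℂ => ζ • w) := by fun_prop
    exact h.usc.comp hc.continuousOn (fun x hx => hx)
  submean z v hv := by
    have := h.submean (z • w) (v • w) (fun ζ hζ => by
      have := hv ζ hζ
      simpa [add_smul, mul_smul] using this)
    simpa [add_smul, mul_smul] using this

lemma SubmeanOn.mono {u : E → EReal} {U V : Set E} (h : SubmeanOn u U) (hV : V ⊆ U) :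
    SubmeanOn u V :=
  ⟨fun z hz => h.lt_top z (hV hz), h.usc.mono hV, fun z w hw => h.submean z w
    fun ζ hζ => hV (hw ζ hζ)⟩

/-- The mean inequality for `q - u` on a circle, when `u ≤ q` there. -/
lemma SubmeanOn.lintegral_circle_le {u : E → EReal} {U : Set E} (h : SubmeanOn u U)
    (hU : IsOpen U) {z w : E} (hzw : ∀ ζ : ℂ, ‖ζ‖ ≤ 1 → z + ζ • w ∈ U) {q : ℝ → ℝ}
    (hq : IntegrableOn q (Ioc 0 (2 * Real.pi))) {m : ℝ} (hm : (m : EReal) ≤ u z)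
    (hle : ∀ θ : ℝ, u (z + Complex.exp (θ * Complex.I) • w) ≤ q θ) :
    AEMeasurable (fun θ : ℝ => u (z + Complex.exp (θ * Complex.I) • w))
      (volume.restrict (Ioc (0 : ℝ) (2 * Real.pi))) ∧
    ∫⁻ θ in Ioc (0 : ℝ) (2 * Real.pi),
        ((q θ : EReal) - u (z + Complex.exp (θ * Complex.I) • w)).toENNReal ≤
      ENNReal.ofReal ((∫ θ in Ioc (0 : ℝ) (2 * Real.pi), q θ) - 2 * Real.pi * m) := by
  classical
  borelize E
  have hpt : ∀ θ : ℝ, z + Complex.exp (θ * Complex.I) • w ∈ U := fun θ =>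
    hzw _ (by rw [Complex.norm_exp_ofReal_mul_I])
  have hmeas : Measurable (fun θ : ℝ => u (z + Complex.exp (θ * Complex.I) • w)) := by
    have hc : Continuous (fun θ : ℝ => z + Complex.exp (θ * Complex.I) • w) := by fun_prop
    have := (measurable_piecewise_top hU h.usc).comp hc.measurable
    convert this using 2 with θ
    simp [hpt θ]
  refine ⟨hmeas.aemeasurable, lintegral_sub_le_of_le_extIntegral hmeas.aemeasurable hq
    (Eventually.of_forall hle) (le_trans ?_ (h.submean z w hzw))⟩
  rw [EReal.coe_mul]
  exact mul_le_mul_of_nonneg_left hm (by exact_mod_cast Real.two_pi_pos.le)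

lemma SubmeanOn.measure_circle_le {u : E → EReal} {U : Set E} (h : SubmeanOn u U)
    (hU : IsOpen U) {z w : E} (hzw : ∀ ζ : ℂ, ‖ζ‖ ≤ 1 → z + ζ • w ∈ U) {m M t : ℝ}
    (hm : (m : EReal) ≤ u z) (hM : ∀ x ∈ U, u x ≤ M) (ht : t < M) :
    volume.restrict (Ioc (0 : ℝ) (2 * Real.pi))
        {θ : ℝ | u (z + Complex.exp (θ * Complex.I) • w) ≤ t} ≤
      ENNReal.ofReal (2 * Real.pi * ((M - m) / (M - t))) := by
  obtain ⟨hmeas, hint⟩ := h.lintegral_circle_le hU hzw (q := fun _ => M)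
    (integrable_const M) hm
    (fun θ => hM _ (hzw _ (by rw [Complex.norm_exp_ofReal_mul_I])))
  have hpos : 0 < M - t := sub_pos.2 ht
  have hmk := meas_ge_le_lintegral_div
    (hmeas.const_sub (M : EReal)).ereal_toENNReal
    (ε := ENNReal.ofReal (M - t)) (by simpa using hpos) (by simp)
  refine (measure_mono ?_).trans (hmk.trans ?_)
  · intro θ hθ
    have : (M : EReal) - t ≤ M - u (z + Complex.exp (θ * Complex.I) • w) :=
      EReal.sub_le_sub le_rfl hθ
    simpa [← EReal.coe_sub] using EReal.toENNReal_le_toENNReal this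
  · refine (ENNReal.div_le_div_right hint _).trans ?_
    rw [← ENNReal.ofReal_div_of_pos hpos]
    refine ENNReal.ofReal_le_ofReal (le_of_eq ?_)
    simp [Real.pi_pos.le]
    ring

end Submean

lemma SubmeanOn.measurableSet_inter_le {E : Type*} [NormedAddCommGroup E]
    [NormedSpace ℂ E] [MeasurableSpace E] [BorelSpace E] {u : E → EReal} {U : Set E} (h : SubmeanOn u U)
    (hU : IsOpen U) (t : EReal) : MeasurableSet (U ∩ {x | u x ≤ t}) := by
  classical
  have := hU.measurableSet.inter
    ((measurable_piecewise_top hU h.usc) (measurableSet_Iic (a := t)))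
  convert this using 1
  ext x
  by_cases hx : x ∈ U <;> simp [hx]

section Ball

variable {E : Type*} [NormedAddCommGroup E] [NormedSpace ℂ E] [MeasurableSpace E] [BorelSpace E]
  [SecondCountableTopology E]

/-- A subset of the ball `B_R(z)` that meets every circle `{z + e^{iθ} w}` in angular measure at
most `2πδ` has measure at most `δ μ(B_R(z))`. -/
lemma measure_le_of_forall_circle {μ : Measure E} [SFinite μ] [μ.IsAddLeftInvariant]
    (hμ : ∀ θ : ℝ, MeasurePreserving (fun x : E => Complex.exp (θ * Complex.I) • x) μ μ)
    {z : E} {R : ℝ} {A : Set E} (hA : MeasurableSet A) (hAb : A ⊆ Metric.ball z R) {δ : ℝ}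
    (h : ∀ w ∈ Metric.ball (0 : E) R, volume.restrict (Ioc (0 : ℝ) (2 * Real.pi))
      {θ : ℝ | z + Complex.exp (θ * Complex.I) • w ∈ A} ≤ ENNReal.ofReal (2 * Real.pi * δ)) :
    μ A ≤ ENNReal.ofReal δ * μ (Metric.ball z R) := by
  set ν : Measure ℝ := volume.restrict (Ioc (0 : ℝ) (2 * Real.pi)) with hν
  have hνu : ν univ = ENNReal.ofReal (2 * Real.pi) := by simp [hν]
  set F : E → ENNReal := A.indicator 1 with hF
  have hFm : Measurable F := measurable_one.indicator hA
  have hcont : Continuous (fun p : ℝ × E => z + Complex.exp (p.1 * Complex.I) • p.2) := by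
    fun_prop
  have hrot : ∀ θ : ℝ, ∫⁻ w, F (z + Complex.exp (θ * Complex.I) • w) ∂μ = μ A := by
    intro θ
    rw [(hμ θ).lintegral_comp (f := fun x => F (z + x)) (hFm.comp (measurable_const_add z)),
      lintegral_add_left_eq_self F z, hF, lintegral_indicator_one hA]
  have hswap : ∫⁻ θ, ∫⁻ w, F (z + Complex.exp (θ * Complex.I) • w) ∂μ ∂ν =
      ∫⁻ w, ∫⁻ θ, F (z + Complex.exp (θ * Complex.I) • w) ∂ν ∂μ :=
    lintegral_lintegral_swap (hFm.comp hcont.measurable).aemeasurable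
  have hin : ∀ w, ∫⁻ θ, F (z + Complex.exp (θ * Complex.I) • w) ∂ν ≤
      (Metric.ball (0 : E) R).indicator (fun _ => ENNReal.ofReal (2 * Real.pi * δ)) w := by
    intro w
    have hS : MeasurableSet {θ : ℝ | z + Complex.exp (θ * Complex.I) • w ∈ A} := by
      have : Continuous (fun θ : ℝ => z + Complex.exp (θ * Complex.I) • w) := by fun_prop
      exact this.measurable hA
    have heq : ∫⁻ θ, F (z + Complex.exp (θ * Complex.I) • w) ∂ν =
        ν {θ : ℝ | z + Complex.exp (θ * Complex.I) • w ∈ A} := by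
      rw [← lintegral_indicator_one hS]
      rfl
    rw [heq]
    by_cases hw : w ∈ Metric.ball (0 : E) R
    · simpa [hw] using h w hw
    · have : {θ : ℝ | z + Complex.exp (θ * Complex.I) • w ∈ A} = ∅ := by
        ext θ
        simp only [mem_ofPred_eq, mem_empty_iff_false, iff_false]
        intro hmem
        have := hAb hmem
        simp [norm_smul, Complex.norm_exp_ofReal_mul_I] at this hw
        linarith
      simp [this]
  have key : ENNReal.ofReal (2 * Real.pi) * μ A ≤
      ENNReal.ofReal (2 * Real.pi) * (ENNReal.ofReal δ * μ (Metric.ball z R)) := by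
    calc ENNReal.ofReal (2 * Real.pi) * μ A
        = ∫⁻ θ, ∫⁻ w, F (z + Complex.exp (θ * Complex.I) • w) ∂μ ∂ν := by
          simp_rw [hrot]
          rw [lintegral_const, hνu, mul_comm]
      _ = _ := hswap
      _ ≤ ∫⁻ w, (Metric.ball (0 : E) R).indicator
            (fun _ => ENNReal.ofReal (2 * Real.pi * δ)) w ∂μ := lintegral_mono hin
      _ = ENNReal.ofReal (2 * Real.pi * δ) * μ (Metric.ball 0 R) := by
          rw [lintegral_indicator_const Metric.isOpen_ball.measurableSet]
      _ = _ := by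
          rw [ENNReal.ofReal_mul Real.two_pi_pos.le, mul_assoc]
          congr 2
          have : Metric.ball (0 : E) R = (fun x => z + x) ⁻¹' Metric.ball z R := by
            ext x; simp
          rw [this, measure_preimage_add]
  exact (ENNReal.mul_le_mul_iff_right (by simpa using Real.two_pi_pos) ENNReal.ofReal_ne_top).1 key

lemma SubmeanOn.measure_ball_le {μ : Measure E} [SFinite μ] [μ.IsAddLeftInvariant]
    (hμ : ∀ θ : ℝ, MeasurePreserving (fun x : E => Complex.exp (θ * Complex.I) • x) μ μ)
    {u : E → EReal} {z : E} {R : ℝ} (h : SubmeanOn u (Metric.ball z R)) {m M t : ℝ}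
    (hm : (m : EReal) ≤ u z) (hM : ∀ x ∈ Metric.ball z R, u x ≤ M) (ht : t < M) :
    μ (Metric.ball z R ∩ {x | u x ≤ t}) ≤
      ENNReal.ofReal ((M - m) / (M - t)) * μ (Metric.ball z R) := by
  refine measure_le_of_forall_circle hμ (h.measurableSet_inter_le Metric.isOpen_ball t)
    inter_subset_left fun w hw => ?_
  have hw' : ‖w‖ < R := by simpa using hw
  refine (measure_mono ?_).trans (h.measure_circle_le Metric.isOpen_ball (w := w) ?_ hm hM ht)
  · intro θ hθ
    exact hθ.2
  · intro ζ hζ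
    simp only [Metric.mem_ball, dist_self_add_left, norm_smul]
    exact (mul_le_of_le_one_left (norm_nonneg _) hζ).trans_lt hw'

lemma SubmeanOn.measure_ball_inter_bot {μ : Measure E} [IsFiniteMeasureOnCompacts μ] [SFinite μ]
    [μ.IsAddLeftInvariant] [ProperSpace E]
    (hμ : ∀ θ : ℝ, MeasurePreserving (fun x : E => Complex.exp (θ * Complex.I) • x) μ μ)
    {u : E → EReal} {z : E} {R : ℝ} (h : SubmeanOn u (Metric.ball z R))
    (hz : u z ≠ ⊥) {M : ℝ} (hM : ∀ x ∈ Metric.ball z R, u x ≤ M) :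
    μ (Metric.ball z R ∩ {x | u x = ⊥}) = 0 := by
  obtain ⟨m, -, hm⟩ := EReal.lt_iff_exists_real_btwn.1 (bot_lt_iff_ne_bot.2 hz)
  have hlim : Tendsto (fun t : ℝ => ENNReal.ofReal ((M - m) / (M - t)) * μ (Metric.ball z R))
      atBot (𝓝 0) := by
    have h1 : Tendsto (fun t : ℝ => (M - m) / (M - t)) atBot (𝓝 0) := by
      refine Tendsto.div_atTop tendsto_const_nhds ?_
      exact tendsto_atTop_add_const_left _ M tendsto_neg_atBot_atTop
    have h2 := ENNReal.Tendsto.mul_const (b := μ (Metric.ball z R))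
      (ENNReal.tendsto_ofReal h1) (Or.inr measure_ball_lt_top.ne)
    simpa using h2
  refine le_antisymm (ge_of_tendsto hlim ?_) zero_le
  filter_upwards [eventually_lt_atBot M] with t ht
  refine (measure_mono ?_).trans (h.measure_ball_le hμ hm.le hM ht)
  rintro x ⟨hx, hx'⟩
  refine ⟨hx, ?_⟩
  have hx' : u x = ⊥ := hx'
  simp [hx']

end Ball

lemma SubmeanOn.exists_le_real {E : Type*} [NormedAddCommGroup E] [NormedSpace ℂ E]
    {u : E → EReal} {U : Set E} (h : SubmeanOn u U) {K : Set E} (hK : IsCompact K) (hKU : K ⊆ U) :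
    ∃ M : ℝ, ∀ x ∈ K, u x ≤ M := by
  rcases K.eq_empty_or_nonempty with rfl | hne
  · exact ⟨0, by simp⟩
  obtain ⟨a, ha, hmax⟩ := (h.usc.mono hKU).exists_isMaxOn hne hK
  obtain ⟨M, hM, -⟩ := EReal.lt_iff_exists_real_btwn.1 (h.lt_top a (hKU ha))
  exact ⟨M, fun x hx => (hmax hx).trans hM.le⟩

section Rotation

variable {E : Type*} [NormedAddCommGroup E] [InnerProductSpace ℝ E] [NormedSpace ℂ E]
  [SMulCommClass ℝ ℂ E] [MeasurableSpace E] [BorelSpace E] [FiniteDimensional ℝ E]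

lemma measurePreserving_smul_of_norm_eq_one {c : ℂ} (hc : ‖c‖ = 1) :
    MeasurePreserving (fun x : E => c • x) volume volume := by
  have hc0 : c ≠ 0 := by rintro rfl; simp at hc
  let e : E ≃ₗᵢ[ℝ] E :=
    { toFun := fun x => c • x
      invFun := fun x => c⁻¹ • x
      map_add' := fun x y => smul_add c x y
      map_smul' := fun r x => (smul_comm r c x).symm
      left_inv := fun x => inv_smul_smul₀ hc0 x
      right_inv := fun x => smul_inv_smul₀ hc0 x
      norm_map' := fun x => by
        change ‖c • x‖ = ‖x‖
        rw [norm_smul, hc, one_mul] }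
  exact e.measurePreserving

lemma measurePreserving_rotation (θ : ℝ) :
    MeasurePreserving (fun x : E => Complex.exp (θ * Complex.I) • x) volume volume :=
  measurePreserving_smul_of_norm_eq_one (Complex.norm_exp_ofReal_mul_I θ)

end Rotation

lemma IsPlurisubharmonicOn.exists_ball_measure_inter_bot {n : ℕ} {φ : Cn n → EReal}
    {U : Set (Cn n)} (h : IsPlurisubharmonicOn φ U) (hU : IsOpen U) {z : Cn n} (hz : z ∈ U) :
    ∃ r > 0, Metric.ball z r ⊆ U ∧ volume (Metric.ball z r ∩ {x | φ x = ⊥}) = 0 := by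
  have key : ∀ y R, Metric.closedBall y R ⊆ U → φ y ≠ ⊥ →
      volume (Metric.ball y R ∩ {x | φ x = ⊥}) = 0 := by
    intro y R hy hne
    obtain ⟨M, hM⟩ := h.submeanOn.exists_le_real (isCompact_closedBall y R) hy
    exact (h.submeanOn.mono (Metric.ball_subset_closedBall.trans hy)).measure_ball_inter_bot
      measurePreserving_rotation hne fun x hx => hM x (Metric.ball_subset_closedBall hx)
  set A : Set (Cn n) := {x | ∃ r > 0, Metric.ball x r ⊆ U ∧
    volume (Metric.ball x r ∩ {x | φ x = ⊥}) = 0} with hA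
  have hAo : IsOpen A := by
    rw [Metric.isOpen_iff]
    rintro x ⟨r, hr, hrU, h0⟩
    refine ⟨r, hr, fun y hy => ?_⟩
    have hsub : Metric.ball y (r - dist y x) ⊆ Metric.ball x r :=
      Metric.ball_subset_ball' (by linarith)
    exact ⟨r - dist y x, sub_pos.2 hy, hsub.trans hrU,
      measure_mono_null (inter_subset_inter_left _ hsub) h0⟩
  have hpre : IsPreconnected (connectedComponentIn U z) := isPreconnected_connectedComponentIn
  refine hpre.subset_of_closure_inter_subset hAo ?_ ?_ (mem_connectedComponentIn hz)
  · obtain ⟨w, hw, hne⟩ := h.ne_bot z hz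
    obtain ⟨R, hR, hRU⟩ := Metric.nhds_basis_closedBall.mem_iff.1
      (hU.mem_nhds (connectedComponentIn_subset U z hw))
    exact ⟨w, hw, R, hR, Metric.ball_subset_closedBall.trans hRU, key w R hRU hne⟩
  · rintro x ⟨hxA, hxV⟩
    obtain ⟨R, hR, hRU⟩ := Metric.nhds_basis_closedBall.mem_iff.1
      (hU.mem_nhds (connectedComponentIn_subset U z hxV))
    obtain ⟨a, ⟨r, hr, hrU, h0⟩, hax⟩ := Metric.mem_closure_iff.1 hxA (R / 6) (by linarith)
    have hmin : 0 < min r (R / 6) := lt_min hr (by linarith)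
    have hex : ∃ y ∈ Metric.ball a (min r (R / 6)), φ y ≠ ⊥ := by
      by_contra! hcon
      have hpos := Metric.measure_ball_pos (volume : Measure (Cn n)) a hmin
      refine hpos.ne' (measure_mono_null ?_ h0)
      exact fun y hy => ⟨Metric.ball_subset_ball (min_le_left _ _) hy, hcon y hy⟩
    obtain ⟨y, hy, hne⟩ := hex
    have hya : dist y a < R / 6 := lt_of_lt_of_le hy (min_le_right _ _)
    have hyx : dist y x < R / 3 := by
      calc dist y x ≤ dist y a + dist a x := dist_triangle _ _ _
        _ < R / 3 := by rw [dist_comm a x]; linarith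
    have h1 : Metric.closedBall y (2 * R / 3) ⊆ U :=
      (Metric.closedBall_subset_closedBall' (by linarith)).trans hRU
    have h2 : Metric.ball x (R / 3) ⊆ Metric.ball y (2 * R / 3) :=
      Metric.ball_subset_ball' (by rw [dist_comm]; linarith)
    exact ⟨R / 3, by linarith, h2.trans (Metric.ball_subset_closedBall.trans h1),
      measure_mono_null (inter_subset_inter_left _ h2) (key y _ h1 hne)⟩

lemma finrank_real_Cn (n : ℕ) : Module.finrank ℝ (Cn n) = 2 * n := by
  rw [finrank_real_of_complex, finrank_euclideanSpace_fin]

lemma lintegral_comp_complex_smul {n : ℕ} {H : Cn n → ENNReal} (hH : Measurable H) {ζ : ℂ}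
    (hζ : ζ ≠ 0) :
    ∫⁻ w, H (ζ • w) = (‖ζ‖ₑ ^ (2 * n))⁻¹ * ∫⁻ u, H u := by
  have hn : ‖ζ‖ ≠ 0 := norm_ne_zero_iff.2 hζ
  set c : ℂ := ζ / ‖ζ‖ with hc
  have hc1 : ‖c‖ = 1 := by simp [hc, hn]
  have hcζ : ∀ w : Cn n, ζ • w = c • ((‖ζ‖ : ℝ) • w) := by
    intro w
    rw [← Complex.coe_smul, smul_smul, hc, div_mul_cancel₀ _ (by exact_mod_cast hn)]
  have hHc : Measurable fun x => H (c • x) := hH.comp (measurable_const_smul c)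
  calc ∫⁻ w, H (ζ • w) = ∫⁻ w, H (c • ((‖ζ‖ : ℝ) • w)) := by simp_rw [hcζ]
    _ = ∫⁻ x, H (c • x) ∂(Measure.map (fun x : Cn n => (‖ζ‖ : ℝ) • x) volume) :=
        (lintegral_map hHc (measurable_const_smul _)).symm
    _ = ENNReal.ofReal |(‖ζ‖ ^ (2 * n))⁻¹| * ∫⁻ x, H (c • x) := by
        rw [Measure.map_addHaar_smul _ hn, finrank_real_Cn, lintegral_smul_measure, smul_eq_mul]
    _ = _ := by
        rw [(measurePreserving_smul_of_norm_eq_one hc1).lintegral_comp hH,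
          abs_of_nonneg (by positivity), ENNReal.ofReal_inv_of_pos (by positivity),
          ENNReal.ofReal_pow (norm_nonneg _), ofReal_norm]

/-- The spherical shell `1 < ‖w‖ < 2` of complex directions. -/
def shell (n : ℕ) : Set (Cn n) := {w : Cn n | 1 < ‖w‖ ∧ ‖w‖ < 2}

lemma isOpen_shell (n : ℕ) : IsOpen (shell n) :=
  (isOpen_lt continuous_const continuous_norm).inter (isOpen_lt continuous_norm continuous_const)

lemma inv_sq_mul_indicator_shell_le {n : ℕ} (u : Cn n) (ζ : ℂ) :
    (‖ζ‖ₑ ^ 2)⁻¹ * (shell n).indicator 1 (ζ⁻¹ • u) ≤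
      (Metric.ball (0 : ℂ) ‖u‖).indicator (fun _ => ENNReal.ofReal (4 / ‖u‖ ^ 2)) ζ := by
  by_cases hmem : ζ⁻¹ • u ∈ shell n
  · have hζ : ζ ≠ 0 := by
      rintro rfl
      have := hmem.1
      simp at this
      linarith
    have hζp : 0 < ‖ζ‖ := norm_pos_iff.2 hζ
    rw [indicator_of_mem hmem]
    obtain ⟨h1, h2⟩ := hmem
    rw [norm_smul, norm_inv, inv_mul_eq_div] at h1 h2
    rw [lt_div_iff₀ hζp, one_mul] at h1
    rw [div_lt_iff₀ hζp] at h2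
    rw [indicator_of_mem (by simpa using h1), Pi.one_apply, mul_one, ← ofReal_norm,
      ← ENNReal.ofReal_pow (norm_nonneg _), ← ENNReal.ofReal_inv_of_pos (by positivity)]
    refine ENNReal.ofReal_le_ofReal ?_
    have hu : 0 < ‖u‖ := hζp.trans h1
    rw [inv_eq_one_div, div_le_div_iff₀ (by positivity) (by positivity)]
    nlinarith
  · simp [hmem]

lemma lintegral_inv_sq_mul_indicator_shell_le {n : ℕ} (u : Cn n) :
    ∫⁻ ζ : ℂ, (‖ζ‖ₑ ^ 2)⁻¹ * (shell n).indicator 1 (ζ⁻¹ • u) ≤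
      ENNReal.ofReal (4 * Real.pi) := by
  refine (lintegral_mono (inv_sq_mul_indicator_shell_le u)).trans ?_
  rw [lintegral_indicator_const Metric.isOpen_ball.measurableSet, Complex.volume_ball]
  rcases (norm_nonneg u).eq_or_lt with h0 | h0
  · simp [← h0]
  · have hpi : (NNReal.pi : ENNReal) = ENNReal.ofReal Real.pi := by
      rw [ENNReal.ofReal, ← NNReal.coe_real_pi, Real.toNNReal_coe]
    rw [hpi, ← ENNReal.ofReal_pow h0.le, ← ENNReal.ofReal_mul (by positivity),
      ← ENNReal.ofReal_mul (by positivity)]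
    refine ENNReal.ofReal_le_ofReal (le_of_eq ?_)
    field_simp

lemma setLIntegral_shell_comp_smul {n : ℕ} (hn : 1 ≤ n) {F : Cn n → ENNReal} (hF : Measurable F)
    {ζ : ℂ} (hζ : ζ ≠ 0) :
    ∫⁻ w in shell n, F (ζ • w) * ‖ζ‖ₑ ^ (2 * n - 2) =
      ∫⁻ u, (‖ζ‖ₑ ^ 2)⁻¹ * (shell n).indicator 1 (ζ⁻¹ • u) * F u := by
  have hAm := (isOpen_shell n).measurableSet
  have he0 : ‖ζ‖ₑ ≠ 0 := by simpa using hζ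
  set G : Cn n → ENNReal := fun u => (shell n).indicator 1 (ζ⁻¹ • u) * F u with hG
  have hGm : Measurable G :=
    ((measurable_one.indicator hAm).comp (measurable_const_smul ζ⁻¹)).mul hF
  have hFm : Measurable fun w => F (ζ • w) := hF.comp (measurable_const_smul ζ)
  simp_rw [mul_assoc]
  rw [lintegral_mul_const _ hFm, ← lintegral_indicator hAm,
    lintegral_const_mul _ hGm]
  have : ∀ w, (shell n).indicator (fun w => F (ζ • w)) w = G (ζ • w) := by
    intro w
    simp only [hG, inv_smul_smul₀ hζ]
    by_cases hw : w ∈ shell n <;> simp [hw]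
  simp_rw [this]
  rw [lintegral_comp_complex_smul hGm hζ, mul_right_comm]
  congr 1
  obtain ⟨k, rfl⟩ := Nat.exists_eq_add_of_le hn
  have hk : 2 * (1 + k) - 2 = 2 * k := by omega
  rw [hk, mul_add, mul_one, pow_add, ENNReal.mul_inv (by simp) (by simp), mul_assoc,
    ENNReal.inv_mul_cancel (by simp [he0]) (by simp), mul_one]

lemma measurable_inv_sq_mul_indicator_shell (n : ℕ) :
    Measurable fun p : ℂ × Cn n =>
      (‖p.1‖ₑ ^ 2)⁻¹ * (shell n).indicator (1 : Cn n → ENNReal) (p.1⁻¹ • p.2) := by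
  have hinv : Measurable fun p : ℂ × Cn n => p.1⁻¹ • p.2 := by fun_prop
  exact Measurable.mul (by fun_prop)
    ((measurable_one.indicator (isOpen_shell n).measurableSet).comp hinv)

lemma lintegral_inv_sq_mul_indicator_shell_mul_le {n : ℕ} (u : Cn n) (c : ENNReal) :
    ∫⁻ ζ : ℂ, (‖ζ‖ₑ ^ 2)⁻¹ * (shell n).indicator 1 (ζ⁻¹ • u) * c ≤
      ENNReal.ofReal (4 * Real.pi) * c := by
  have hpair : Measurable fun ζ : ℂ => (ζ, u) := measurable_prodMk_right
  have hKu := (measurable_inv_sq_mul_indicator_shell n).comp hpair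
  have := lintegral_mul_const (μ := volume) c hKu
  simp only [Function.comp_apply] at this
  rw [this]
  gcongr
  exact lintegral_inv_sq_mul_indicator_shell_le u

/-- Integration over `ℂⁿ` controls weighted integrals over almost all complex lines through the
origin. -/
lemma lintegral_lintegral_line_le {n : ℕ} (hn : 1 ≤ n) {F : Cn n → ENNReal} (hF : Measurable F) :
    ∫⁻ w in shell n, ∫⁻ ζ : ℂ, F (ζ • w) * ‖ζ‖ₑ ^ (2 * n - 2) ≤
      ENNReal.ofReal (4 * Real.pi) * ∫⁻ u, F u := by
  have hK := measurable_inv_sq_mul_indicator_shell n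
  have hae0 : ∀ᵐ ζ : ℂ, ζ ≠ 0 := by simp [ae_iff]
  have hm1 : Measurable fun p : Cn n × ℂ => F (p.2 • p.1) * ‖p.2‖ₑ ^ (2 * n - 2) := by
    have hsm : Measurable fun p : Cn n × ℂ => p.2 • p.1 := by fun_prop
    exact (hF.comp hsm).mul (by fun_prop)
  have hm2 : Measurable fun p : ℂ × Cn n =>
      (‖p.1‖ₑ ^ 2)⁻¹ * (shell n).indicator (1 : Cn n → ENNReal) (p.1⁻¹ • p.2) * F p.2 :=
    hK.mul (hF.comp measurable_snd)
  rw [lintegral_lintegral_swap hm1.aemeasurable]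
  have h1 : ∫⁻ ζ : ℂ, ∫⁻ w in shell n, F (ζ • w) * ‖ζ‖ₑ ^ (2 * n - 2) =
      ∫⁻ ζ : ℂ, ∫⁻ u, (‖ζ‖ₑ ^ 2)⁻¹ * (shell n).indicator 1 (ζ⁻¹ • u) * F u := by
    refine lintegral_congr_ae ?_
    filter_upwards [hae0] with ζ hζ using setLIntegral_shell_comp_smul hn hF hζ
  have h2 : ∫⁻ ζ : ℂ, ∫⁻ u, (‖ζ‖ₑ ^ 2)⁻¹ * (shell n).indicator 1 (ζ⁻¹ • u) * F u =
      ∫⁻ u, ∫⁻ ζ : ℂ, (‖ζ‖ₑ ^ 2)⁻¹ * (shell n).indicator 1 (ζ⁻¹ • u) * F u :=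
    lintegral_lintegral_swap hm2.aemeasurable
  rw [h1, h2, ← lintegral_const_mul _ hF]
  exact lintegral_mono fun u => lintegral_inv_sq_mul_indicator_shell_mul_le u (F u)

lemma exists_line_lintegral_ne_top {n : ℕ} (hn : 1 ≤ n) {F : Cn n → ENNReal}
    (hF : AEMeasurable F) (hfin : ∫⁻ u, F u ≠ ⊤) :
    ∃ w : Cn n, 1 < ‖w‖ ∧ ‖w‖ < 2 ∧ ∫⁻ ζ : ℂ, F (ζ • w) * ‖ζ‖ₑ ^ (2 * n - 2) ≠ ⊤ := by
  set N := toMeasurable volume {x | ¬ F x = hF.mk F x} with hN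
  have hN0 : volume N = 0 := by
    rw [hN, measure_toMeasurable]
    exact hF.ae_eq_mk
  set F' : Cn n → ENNReal := fun x => hF.mk F x + N.indicator (fun _ => ⊤) x with hF'
  have hF'm : Measurable F' :=
    hF.measurable_mk.add (measurable_const.indicator (measurableSet_toMeasurable _ _))
  have hle : ∀ x, F x ≤ F' x := by
    intro x
    by_cases hx : x ∈ N
    · simp [hF', hx]
    · have : F x = hF.mk F x := by
        by_contra hne
        exact hx (subset_toMeasurable volume _ hne)
      simp [hF', hx, this]
  have hfin' : ∫⁻ u, F' u ≠ ⊤ := by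
    rw [hF', lintegral_add_left hF.measurable_mk,
      lintegral_indicator_const (measurableSet_toMeasurable _ _), hN0, mul_zero, add_zero,
      lintegral_congr_ae hF.ae_eq_mk.symm]
    exact hfin
  have hAo := isOpen_shell n
  have hAne : (shell n).Nonempty := by
    refine ⟨EuclideanSpace.single ⟨0, hn⟩ (3 / 2 : ℂ), ?_⟩
    simp [shell]
    norm_num
  have hApos : volume (shell n) ≠ 0 := (hAo.measure_pos volume hAne).ne'
  have hbound := lintegral_lintegral_line_le hn hF'm
  have hnt : ∫⁻ w in shell n, ∫⁻ ζ : ℂ, F' (ζ • w) * ‖ζ‖ₑ ^ (2 * n - 2) ≠ ⊤ :=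
    ne_top_of_le_ne_top (ENNReal.mul_ne_top ENNReal.ofReal_ne_top hfin') hbound
  by_contra! hcon
  have htop : ∀ w ∈ shell n, ∫⁻ ζ : ℂ, F' (ζ • w) * ‖ζ‖ₑ ^ (2 * n - 2) = ⊤ := by
    intro w hw
    refine top_le_iff.1 ((hcon w hw.1 hw.2).symm.le.trans ?_)
    exact lintegral_mono fun ζ => mul_le_mul_left (hle _) _
  rw [setLIntegral_congr_fun hAo.measurableSet htop] at hnt
  simp [ENNReal.top_mul hApos] at hnt

lemma one_add_mul_exp_ne_zero {δ : ℝ} (h0 : 0 < δ) (h1 : δ < 1) (θ : ℝ) :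
    (1 : ℂ) + δ * Complex.exp (θ * Complex.I) ≠ 0 := by
  intro h
  have h2 : (δ : ℂ) * Complex.exp (θ * Complex.I) = -1 := by linear_combination h
  have h3 := congrArg norm h2
  simp [Complex.norm_exp_ofReal_mul_I, abs_of_pos h0] at h3
  linarith

lemma continuous_log_norm_one_add_mul_exp {δ : ℝ} (h0 : 0 < δ) (h1 : δ < 1) :
    Continuous fun θ : ℝ => Real.log ‖(1 : ℂ) + δ * Complex.exp (θ * Complex.I)‖ :=
  Continuous.log (by fun_prop) fun θ => norm_ne_zero_iff.2 (one_add_mul_exp_ne_zero h0 h1 θ)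

lemma integral_log_norm_one_add_mul_exp {δ : ℝ} (h0 : 0 < δ) (h1 : δ < 1) :
    ∫ θ in Ioc (0 : ℝ) (2 * Real.pi),
      Real.log ‖(1 : ℂ) + δ * Complex.exp (θ * Complex.I)‖ = 0 := by
  have h := circleAverage_log_norm_sub_const_eq_log_radius_add_posLog (a := 0) (c := 1) (R := δ)
    h0.ne'
  rw [Real.circleAverage_def] at h
  have h2 : Real.posLog (δ⁻¹ * ‖(1 : ℂ) - 0‖) = - Real.log δ := by
    rw [Real.posLog_eq_log]
    · simp
    · simpa [abs_of_pos h0] using (one_le_inv₀ h0).2 h1.le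
  rw [h2] at h
  simp only [sub_zero, add_neg_cancel, smul_eq_mul, mul_eq_zero, inv_eq_zero,
    Real.two_pi_pos.ne', false_or, circleMap] at h
  rwa [intervalIntegral.integral_of_le Real.two_pi_pos.le] at h

lemma one_lt_norm_one_add_mul_exp {δ θ : ℝ} (h0 : 0 < δ) (hθ : 0 < Real.cos θ) :
    1 < ‖(1 : ℂ) + δ * Complex.exp (θ * Complex.I)‖ := by
  have h1 : ((1 : ℂ) + δ * Complex.exp (θ * Complex.I)).re = 1 + δ * Real.cos θ := by
    simp [Complex.exp_ofReal_mul_I_re]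
  have h2 := Complex.re_le_norm ((1 : ℂ) + δ * Complex.exp (θ * Complex.I))
  rw [h1] at h2
  nlinarith

/-- If `u` is submean and `u - s log |ζ|` has the local upper bound `M` on a punctured disc,
attained at `a`, then it is attained at some point of larger modulus. -/
lemma SubmeanOn.exists_norm_gt_of_max {u : ℂ → EReal} {R ρ : ℝ}
    (h : SubmeanOn u (Metric.ball 0 R)) (hρR : ρ < R) {s M : ℝ} {a : ℂ}
    (ha0 : a ≠ 0) (haρ : ‖a‖ < ρ)
    (hle : ∀ ζ : ℂ, ζ ≠ 0 → ‖ζ‖ ≤ ρ → u ζ ≤ ((s * Real.log ‖ζ‖ + M : ℝ) : EReal))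
    (ha : ((s * Real.log ‖a‖ + M : ℝ) : EReal) ≤ u a) :
    ∃ ζ : ℂ, ‖a‖ < ‖ζ‖ ∧ ‖ζ‖ ≤ ρ ∧ ((s * Real.log ‖ζ‖ + M : ℝ) : EReal) ≤ u ζ := by
  have hap : 0 < ‖a‖ := norm_pos_iff.2 ha0
  obtain ⟨δ, hδ0, hδ⟩ : ∃ δ : ℝ, 0 < δ ∧ δ < min 1 (ρ / ‖a‖ - 1) := by
    refine exists_between (lt_min one_pos ?_)
    rw [sub_pos, one_lt_div hap]
    exact haρ
  have hδ1 : δ < 1 := hδ.trans_le (min_le_left _ _)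
  have hδρ : (1 + δ) * ‖a‖ < ρ := by
    have := hδ.trans_le (min_le_right _ _)
    rw [← lt_div_iff₀ hap]
    linarith
  have hfac : ∀ ζ : ℂ, a + ζ • (δ * a) = a * (1 + δ * ζ) := fun ζ => by
    simp only [smul_eq_mul]; ring
  have hnorm : ∀ ζ : ℂ, ‖ζ‖ ≤ 1 → ‖a * (1 + δ * ζ)‖ < ρ := by
    intro ζ hζ
    rw [norm_mul]
    have : ‖(1 : ℂ) + δ * ζ‖ ≤ 1 + δ := by
      refine (norm_add_le _ _).trans ?_
      simp only [norm_one, norm_mul, Complex.norm_real, Real.norm_eq_abs, abs_of_pos hδ0]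
      nlinarith
    nlinarith
  have hcirc : ∀ θ : ℝ, ‖a + Complex.exp (θ * Complex.I) • (δ * a)‖ < ρ := fun θ => by
    rw [hfac]
    exact hnorm _ (by rw [Complex.norm_exp_ofReal_mul_I])
  have hcirc0 : ∀ θ : ℝ, a + Complex.exp (θ * Complex.I) • (δ * a) ≠ 0 := fun θ => by
    rw [hfac]
    exact mul_ne_zero ha0 (one_add_mul_exp_ne_zero hδ0 hδ1 θ)
  set q : ℝ → ℝ := fun θ => s * Real.log ‖a + Complex.exp (θ * Complex.I) • (δ * a)‖ + M with hq
  have hqeq : q = fun θ : ℝ => (s * Real.log ‖a‖ + M) +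
      s * Real.log ‖(1 : ℂ) + δ * Complex.exp (θ * Complex.I)‖ := by
    funext θ
    simp only [hq]
    rw [hfac, norm_mul, Real.log_mul hap.ne'
      (norm_ne_zero_iff.2 (one_add_mul_exp_ne_zero hδ0 hδ1 θ))]
    ring
  have hqi : IntegrableOn (fun θ : ℝ => s * Real.log ‖(1 : ℂ) + δ * Complex.exp (θ * Complex.I)‖)
      (Ioc 0 (2 * Real.pi)) :=
    ((continuous_const.mul (continuous_log_norm_one_add_mul_exp hδ0 hδ1)).integrableOn_Icc).mono_set
      Ioc_subset_Icc_self
  have hconst : IntegrableOn (fun _ : ℝ => s * Real.log ‖a‖ + M) (Ioc 0 (2 * Real.pi)) :=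
    integrable_const _
  have hqint : ∫ θ in Ioc (0 : ℝ) (2 * Real.pi), q θ =
      2 * Real.pi * (s * Real.log ‖a‖ + M) := by
    rw [hqeq, integral_add hconst hqi, integral_const_mul,
      integral_log_norm_one_add_mul_exp hδ0 hδ1]
    simp [Real.pi_pos.le]
  obtain ⟨hmeas, hint⟩ := h.lintegral_circle_le Metric.isOpen_ball (z := a) (w := δ * a)
    (fun ζ hζ => by
      rw [hfac, mem_ball_zero_iff]
      exact (hnorm ζ hζ).trans hρR)
    (q := q) (by rw [hqeq]; exact hconst.add hqi) ha
    (fun θ => hle _ (hcirc0 θ) (hcirc θ).le)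
  rw [hqint, sub_self, ENNReal.ofReal_zero, nonpos_iff_eq_zero] at hint
  have hqm : AEMeasurable (fun θ : ℝ => ((q θ : ℝ) : EReal))
      (volume.restrict (Ioc (0 : ℝ) (2 * Real.pi))) := by
    have : Measurable q := by
      rw [hqeq]
      exact (continuous_const.add (continuous_const.mul
        (continuous_log_norm_one_add_mul_exp hδ0 hδ1))).measurable
    exact this.coe_real_ereal.aemeasurable
  have hae := (lintegral_eq_zero_iff' (hqm.sub hmeas).ereal_toENNReal).1 hint
  have hsub : Ioo (0 : ℝ) (Real.pi / 2) ⊆ Ioc 0 (2 * Real.pi) := fun x hx =>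
    ⟨hx.1, by linarith [hx.2, Real.pi_pos]⟩
  have hae' : ∀ᵐ θ ∂(volume.restrict (Ioo (0 : ℝ) (Real.pi / 2))),
      ((q θ : EReal) - u (a + Complex.exp (θ * Complex.I) • (δ * a))).toENNReal = 0 :=
    ae_mono (Measure.restrict_mono_set volume hsub) hae
  have hne : (ae (volume.restrict (Ioo (0 : ℝ) (Real.pi / 2)))).NeBot := by
    rw [ae_neBot, Ne, Measure.restrict_eq_zero]
    simp [Real.pi_pos]
  obtain ⟨θ, hθ1, hθ2⟩ := (hae'.and (ae_restrict_mem measurableSet_Ioo)).exists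
  refine ⟨a + Complex.exp (θ * Complex.I) • (δ * a), ?_, (hcirc θ).le, ?_⟩
  · rw [hfac, norm_mul]
    have := one_lt_norm_one_add_mul_exp hδ0
      (Real.cos_pos_of_mem_Ioo ⟨by linarith [hθ2.1, Real.pi_pos], hθ2.2⟩)
    nlinarith
  · have h0 : ((q θ : EReal) - u (a + Complex.exp (θ * Complex.I) • (δ * a))).toENNReal = 0 := hθ1
    rw [EReal.toENNReal_eq_zero_iff, EReal.sub_nonpos] at h0
    exact h0

lemma SubmeanOn.le_mul_log_of_eventually_lt {u : ℂ → EReal} {R ρ : ℝ}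
    (h : SubmeanOn u (Metric.ball 0 R)) (hρR : ρ < R) {s s' C : ℝ} (hs : s < s')
    (hev : ∀ᶠ ζ : ℂ in 𝓝[≠] 0, u ζ ≤ ((s' * Real.log ‖ζ‖ : ℝ) : EReal))
    (hC : ∀ ζ : ℂ, ‖ζ‖ = ρ → u ζ ≤ ((s * Real.log ‖ζ‖ + C : ℝ) : EReal))
    {ζ : ℂ} (hζ0 : ζ ≠ 0) (hζ : ‖ζ‖ ≤ ρ) :
    u ζ ≤ ((s * Real.log ‖ζ‖ + C : ℝ) : EReal) := by
  by_contra! hcon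
  set v : ℂ → EReal := fun ζ => u ζ + ((-(s * Real.log ‖ζ‖) : ℝ) : EReal) with hv
  have hv_le : ∀ (ζ : ℂ) (c : ℝ), v ζ ≤ c ↔ u ζ ≤ ((s * Real.log ‖ζ‖ + c : ℝ) : EReal) := by
    intro ζ c
    simp only [hv]
    generalize s * Real.log ‖ζ‖ = t
    induction u ζ with
    | bot => simp
    | top => rw [EReal.top_add_coe]; simp only [top_le_iff, EReal.coe_ne_top]
    | coe x => norm_cast; constructor <;> intro <;> linarith
  have hv_ge : ∀ (ζ : ℂ) (c : ℝ), c ≤ v ζ ↔ ((s * Real.log ‖ζ‖ + c : ℝ) : EReal) ≤ u ζ := by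
    intro ζ c
    simp only [hv]
    generalize s * Real.log ‖ζ‖ = t
    induction u ζ with
    | bot => simp
    | top => rw [EReal.top_add_coe]; simp
    | coe x => norm_cast; constructor <;> intro <;> linarith
  have hlog : ∀ᶠ ζ : ℂ in 𝓝[≠] 0, Real.log ‖ζ‖ ≤ C / (s' - s) := by
    have : Tendsto (fun ζ : ℂ => Real.log ‖ζ‖) (𝓝[≠] 0) atBot :=
      Real.tendsto_log_nhdsGT_zero.comp tendsto_norm_nhdsNE_zero
    exact this.eventually (eventually_le_atBot _)
  obtain ⟨η, hη, hηv⟩ : ∃ η > 0, ∀ ζ : ℂ, ζ ≠ 0 → ‖ζ‖ < η → v ζ ≤ C := by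
    have hh := hev.and hlog
    rw [eventually_nhdsWithin_iff, Metric.eventually_nhds_iff] at hh
    obtain ⟨η, hη, hh⟩ := hh
    refine ⟨η, hη, fun ζ h0 hlt => ?_⟩
    obtain ⟨h1, h2⟩ := hh (by simpa using hlt) h0
    rw [hv_le]
    refine h1.trans (EReal.coe_le_coe_iff.2 ?_)
    rw [le_div_iff₀ (sub_pos.2 hs)] at h2
    linarith
  have hζv : (C : EReal) < v ζ := by
    rw [← not_le, hv_le, not_le]
    exact hcon
  set K : Set ℂ := Metric.closedBall 0 ρ \ Metric.ball 0 η with hK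
  have hKc : IsCompact K := (isCompact_closedBall _ _).diff Metric.isOpen_ball
  have hK0 : ∀ x ∈ K, x ≠ 0 := by
    rintro x hx rfl
    exact hx.2 (by simpa using hη)
  have hKle : ∀ x ∈ K, ‖x‖ ≤ ρ := fun x hx => by simpa using hx.1
  have hKU : K ⊆ Metric.ball 0 R := fun x hx => by simpa using (hKle x hx).trans_lt hρR
  have hζK : ζ ∈ K := by
    refine ⟨by simpa using hζ, fun hb => ?_⟩
    exact absurd (hηv ζ hζ0 (by simpa using hb)) (not_le.2 hζv)
  have husc : UpperSemicontinuousOn v K := by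
    refine (h.usc.mono hKU).add' ?_ ?_
    · refine ContinuousOn.upperSemicontinuousOn ?_
      refine continuous_coe_real_ereal.comp_continuousOn ?_
      refine (continuousOn_const.mul (ContinuousOn.log continuous_norm.continuousOn ?_)).neg
      exact fun x hx => norm_ne_zero_iff.2 (hK0 x hx)
    · intro x hx
      exact EReal.continuousAt_add (Or.inr (EReal.coe_ne_bot _)) (Or.inr (EReal.coe_ne_top _))
  obtain ⟨a, haK, hmax⟩ := husc.exists_isMaxOn ⟨ζ, hζK⟩ hKc
  have hav : (C : EReal) < v a := hζv.trans_le (hmax hζK)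
  have hvtop : v a ≠ ⊤ := by
    obtain ⟨m, hm, -⟩ := EReal.lt_iff_exists_real_btwn.1 (h.lt_top a (hKU haK))
    have : v a ≤ ((m - s * Real.log ‖a‖ : ℝ) : EReal) := by
      rw [hv_le]
      exact hm.le.trans (EReal.coe_le_coe_iff.2 (by linarith))
    exact (this.trans_lt (EReal.coe_lt_top _)).ne
  obtain ⟨M, hM⟩ : ∃ M : ℝ, (M : EReal) = v a :=
    ⟨(v a).toReal, EReal.coe_toReal hvtop (ne_bot_of_gt hav)⟩
  have hCM : C < M := by
    rw [← hM] at hav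
    exact_mod_cast hav
  obtain ⟨b, hbK, hbmax⟩ := (husc.isCompact_inter_preimage_Ici hKc (v a)).exists_isMaxOn
    ⟨a, haK, le_refl (v a)⟩ continuous_norm.continuousOn
  have hvle : ∀ x : ℂ, x ≠ 0 → ‖x‖ ≤ ρ → v x ≤ M := by
    intro x hx0 hxρ
    by_cases hxη : ‖x‖ < η
    · exact (hηv x hx0 hxη).trans (EReal.coe_le_coe_iff.2 hCM.le)
    · rw [hM]
      exact hmax ⟨by simpa using hxρ, by simpa using hxη⟩
  have hbM : (M : EReal) ≤ v b := hM.trans_le hbK.2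
  have hbρ : ‖b‖ < ρ := by
    refine lt_of_le_of_ne (hKle b hbK.1) fun heq => ?_
    have := hbM.trans ((hv_le b C).2 (hC b heq))
    exact absurd (EReal.coe_le_coe_iff.1 this) (not_le.2 hCM)
  obtain ⟨x, hx1, hx2, hx3⟩ := h.exists_norm_gt_of_max hρR (hK0 b hbK.1) hbρ
    (fun x h0 hx => (hv_le x M).1 (hvle x h0 hx)) ((hv_ge b M).1 hbM)
  have hxK : x ∈ K := by
    refine ⟨by simpa using hx2, ?_⟩
    have := hbK.1.2
    simp only [mem_ball_zero_iff, not_lt] at this ⊢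
    linarith
  have := hbmax (⟨hxK, show v a ≤ v x by rw [← hM, hv_ge]; exact hx3⟩ :
    x ∈ K ∩ v ⁻¹' Ici (v a))
  simp only [mem_ofPred_eq] at this
  linarith

/-- A submean function on a disc with `u ≤ s log |ζ|` near `0` for all `s < b` satisfies
`u ≤ b log |ζ| + O(1)`. -/
lemma SubmeanOn.exists_le_mul_log_add {u : ℂ → EReal} {R : ℝ} (hR : 0 < R)
    (h : SubmeanOn u (Metric.ball 0 R)) {b : ℝ}
    (hev : ∀ s < b, ∀ᶠ ζ : ℂ in 𝓝[≠] 0, u ζ ≤ ((s * Real.log ‖ζ‖ : ℝ) : EReal)) :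
    ∃ C : ℝ, ∀ᶠ ζ : ℂ in 𝓝[≠] 0, u ζ ≤ ((b * Real.log ‖ζ‖ + C : ℝ) : EReal) := by
  have hρ : 0 < R / 2 := by linarith
  have hρR : R / 2 < R := by linarith
  obtain ⟨M, hM⟩ := h.exists_le_real (isCompact_closedBall 0 (R / 2))
    (Metric.closedBall_subset_ball hρR)
  refine ⟨M - b * Real.log (R / 2), ?_⟩
  have hball : ∀ᶠ ζ : ℂ in 𝓝[≠] 0, ζ ∈ Metric.ball (0 : ℂ) (R / 2) :=
    mem_nhdsWithin_of_mem_nhds (Metric.ball_mem_nhds _ hρ)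
  filter_upwards [hball, self_mem_nhdsWithin] with ζ hζ hζ0
  have key : ∀ s < b, u ζ ≤ ((s * Real.log ‖ζ‖ + (M - s * Real.log (R / 2)) : ℝ) : EReal) := by
    intro s hs
    obtain ⟨s', h1, h2⟩ := exists_between hs
    refine h.le_mul_log_of_eventually_lt hρR h1 (hev s' h2) (fun x hx => ?_) hζ0
      (le_of_lt (by simpa using hζ))
    rw [hx]
    exact (hM x (by simp [hx])).trans (EReal.coe_le_coe_iff.2 (by linarith))
  have hlim : Tendsto (fun s : ℝ =>
      ((s * Real.log ‖ζ‖ + (M - s * Real.log (R / 2)) : ℝ) : EReal)) (𝓝[<] b)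
      (𝓝 ((b * Real.log ‖ζ‖ + (M - b * Real.log (R / 2)) : ℝ) : EReal)) := by
    refine (Continuous.tendsto ?_ b).mono_left nhdsWithin_le_nhds
    exact continuous_coe_real_ereal.comp (by fun_prop)
  refine ge_of_tendsto hlim ?_
  filter_upwards [self_mem_nhdsWithin] with s hs using key s hs

/-- Finitely many analytic germs at `0` are either all zero, or `∑ |f k|² = |ζ|^{2N} H` with `H`
continuous and positive at `0`. -/
lemma sum_norm_sq_factor {m : ℕ} {f : Fin m → ℂ → ℂ} (hf : ∀ k, AnalyticAt ℂ (f k) 0) :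
    (∀ᶠ ζ in 𝓝 (0 : ℂ), ∀ k, f k ζ = 0) ∨
    ∃ (N : ℕ) (H : ℂ → ℝ), ContinuousAt H 0 ∧ 0 < H 0 ∧
      ∀ᶠ ζ in 𝓝 (0 : ℂ), ∑ k, ‖f k ζ‖ ^ 2 = (‖ζ‖ ^ N) ^ 2 * H ζ := by
  by_cases hall : ∀ k, analyticOrderAt (f k) 0 = ⊤
  · left
    rw [eventually_all]
    exact fun k => analyticOrderAt_eq_top.1 (hall k)
  right
  push Not at hall
  obtain ⟨k₁, hk₁⟩ := hall
  obtain ⟨k₀, -, hk₀⟩ := Finset.exists_min_image Finset.univ (fun k => analyticOrderAt (f k) 0)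
    ⟨k₁, Finset.mem_univ _⟩
  have hne : analyticOrderAt (f k₀) 0 ≠ ⊤ :=
    ne_top_of_le_ne_top hk₁ (hk₀ k₁ (Finset.mem_univ _))
  obtain ⟨N, hN⟩ := ENat.ne_top_iff_exists.1 hne
  have hfac : ∀ k, ∃ g : ℂ → ℂ, AnalyticAt ℂ g 0 ∧ (∀ᶠ ζ in 𝓝 (0 : ℂ), f k ζ = ζ ^ N * g ζ) ∧
      (k = k₀ → g 0 ≠ 0) := by
    intro k
    by_cases hk : k = k₀
    · subst hk
      obtain ⟨g, h1, h2, h3⟩ := ((hf k).analyticOrderAt_eq_natCast).1 hN.symm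
      exact ⟨g, h1, by simpa using h3, fun _ => h2⟩
    · obtain ⟨g, h1, h3⟩ := (natCast_le_analyticOrderAt (hf k)).1
        (hN.trans_le (hk₀ k (Finset.mem_univ _)))
      exact ⟨g, h1, by simpa using h3, fun h => absurd h hk⟩
  choose g hg1 hg2 hg3 using hfac
  refine ⟨N, fun ζ => ∑ k, ‖g k ζ‖ ^ 2, ?_, ?_, ?_⟩
  · have : ∀ k, ContinuousAt (g k) 0 := fun k => (hg1 k).continuousAt
    exact tendsto_finsetSum _ fun k _ => ((this k).norm.pow 2)
  · refine Finset.sum_pos' (fun k _ => by positivity) ⟨k₀, Finset.mem_univ _, ?_⟩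
    have := norm_pos_iff.2 (hg3 k₀ rfl)
    positivity
  · filter_upwards [eventually_all.2 hg2] with ζ hζ
    rw [Finset.mul_sum]
    refine Finset.sum_congr rfl fun k _ => ?_
    rw [hζ k, norm_mul, norm_pow, mul_pow]

/-- In one variable, analytic singularities at `0` are `-∞` or logarithmic poles. -/
lemma HasAnalyticSingularitiesOn.eventually_bot_or_log {u : ℂ → EReal} {D : Set ℂ}
    (h : HasAnalyticSingularitiesOn u D) (h0 : (0 : ℂ) ∈ D) :
    (∀ᶠ ζ in 𝓝[≠] (0 : ℂ), u ζ = ⊥) ∨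
    ∃ a C : ℝ, ∀ᶠ ζ in 𝓝[≠] (0 : ℂ),
      ((a * Real.log ‖ζ‖ - C : ℝ) : EReal) ≤ u ζ ∧ u ζ ≤ ((a * Real.log ‖ζ‖ + C : ℝ) : EReal) := by
  obtain ⟨W, hWo, hW0, -, c, m, f, M, hc, hf, hu⟩ := h 0 h0
  have hW : W ∈ 𝓝 (0 : ℂ) := hWo.mem_nhds hW0
  rcases sum_norm_sq_factor fun k => (hf k).analyticAt hW with hz | ⟨N, H, hHc, hH0, hH⟩
  · left
    refine Eventually.filter_mono nhdsWithin_le_nhds ?_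
    filter_upwards [hz, hW] with ζ hζ hζW
    have h2 := (hu ζ hζW).2
    simp only [hζ, enorm_zero, ne_eq, OfNat.ofNat_ne_zero, not_false_eq_true, zero_pow,
      Finset.sum_const_zero, ENNReal.log_zero] at h2
    rw [EReal.coe_mul_bot_of_pos (by linarith), EReal.bot_add] at h2
    exact le_bot_iff.1 h2
  · right
    refine ⟨c * N, c / 2 * (|Real.log (H 0)| + 1) + M, ?_⟩
    have hlog : ∀ᶠ ζ in 𝓝 (0 : ℂ), |Real.log (H ζ) - Real.log (H 0)| < 1 :=
      (hHc.log hH0.ne').eventually (Metric.ball_mem_nhds _ one_pos)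
    have hpos : ∀ᶠ ζ in 𝓝 (0 : ℂ), 0 < H ζ := hHc.eventually (lt_mem_nhds hH0)
    filter_upwards [nhdsWithin_le_nhds hlog, nhdsWithin_le_nhds hpos, nhdsWithin_le_nhds hH,
      nhdsWithin_le_nhds hW, self_mem_nhdsWithin] with ζ h1 h2 h3 h4 h5
    have hζ : 0 < ‖ζ‖ := norm_pos_iff.2 h5
    have hsum : ∑ k, ‖f k ζ‖ₑ ^ 2 = ENNReal.ofReal ((‖ζ‖ ^ N) ^ 2 * H ζ) := by
      rw [← h3, ENNReal.ofReal_sum_of_nonneg fun k _ => by positivity]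
      refine Finset.sum_congr rfl fun k _ => ?_
      rw [ENNReal.ofReal_pow (norm_nonneg _), ofReal_norm]
    have hlg : ENNReal.log (∑ k, ‖f k ζ‖ₑ ^ 2) =
        ((2 * N * Real.log ‖ζ‖ + Real.log (H ζ) : ℝ) : EReal) := by
      rw [hsum, ENNReal.log_ofReal_of_pos (by positivity), Real.log_mul (by positivity) h2.ne',
        Real.log_pow, Real.log_pow, EReal.coe_eq_coe_iff]
      push_cast
      ring
    obtain ⟨hl, hr⟩ := hu ζ h4
    rw [hlg, ← EReal.coe_mul] at hl hr
    rw [← EReal.coe_sub] at hl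
    rw [← EReal.coe_add] at hr
    have hH1 := abs_lt.1 h1
    have hH2 := abs_le.1 (le_refl |Real.log (H 0)|)
    have e1 : c / 2 * Real.log (H ζ) ≤ c / 2 * (|Real.log (H 0)| + 1) :=
      mul_le_mul_of_nonneg_left (by linarith) (by linarith)
    have e2 : c / 2 * (-(|Real.log (H 0)| + 1)) ≤ c / 2 * Real.log (H ζ) :=
      mul_le_mul_of_nonneg_left (by linarith) (by linarith)
    constructor
    · refine le_trans (EReal.coe_le_coe_iff.2 ?_) hl
      linarith
    · refine hr.trans (EReal.coe_le_coe_iff.2 ?_)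
      linarith

lemma expNegTwo_coe (x : ℝ) : expNegTwo (x : EReal) = Real.exp (-2 * x) := by
  have : (-2 : EReal) * (x : EReal) = ((-2 * x : ℝ) : EReal) := by
    rw [EReal.coe_mul]
    rfl
  rw [expNegTwo, this, EReal.exp_coe, ENNReal.toReal_ofReal (Real.exp_pos _).le]

lemma expNegTwo_bot : expNegTwo ⊥ = 0 := by
  have : (-2 : EReal) * ⊥ = ⊤ := EReal.coe_mul_bot_of_neg (x := -2) (by norm_num)
  rw [expNegTwo, this, EReal.exp_top, ENNReal.toReal_top]

lemma expNegTwo_top : expNegTwo ⊤ = 0 := by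
  have : (-2 : EReal) * ⊤ = ⊥ := EReal.coe_mul_top_of_neg (x := -2) (by norm_num)
  rw [expNegTwo, this, EReal.exp_bot, ENNReal.toReal_zero]

lemma expNegTwo_le {x : EReal} {y : ℝ} (h : (y : EReal) ≤ x) :
    expNegTwo x ≤ Real.exp (-2 * y) := by
  induction x with
  | bot => simp at h
  | top => rw [expNegTwo_top]; positivity
  | coe x =>
    have h : y ≤ x := by exact_mod_cast h
    rw [expNegTwo_coe]
    exact Real.exp_le_exp.2 (by linarith)

lemma le_expNegTwo {x : EReal} {y : ℝ} (hx : x ≠ ⊥) (h : x ≤ (y : EReal)) :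
    Real.exp (-2 * y) ≤ expNegTwo x := by
  induction x with
  | bot => exact absurd rfl hx
  | top => simp at h
  | coe x =>
    have h : x ≤ y := by exact_mod_cast h
    rw [expNegTwo_coe]
    exact Real.exp_le_exp.2 (by linarith)

lemma extend_coe (χ : ℝ → ℝ) (t : ℝ) : extend χ (t : EReal) = (χ t : EReal) := rfl

lemma tendsto_log_norm_nhdsNE_zero : Tendsto (fun ζ : ℂ => Real.log ‖ζ‖) (𝓝[≠] 0) atBot :=
  Real.tendsto_log_nhdsGT_zero.comp tendsto_norm_nhdsNE_zero

lemma norm_mem_of_mem_ball_half {p ζ : ℂ} (h : ζ ∈ Metric.ball p (‖p‖ / 2)) :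
    0 < ‖ζ‖ ∧ ‖ζ‖ < 2 * ‖p‖ := by
  rw [mem_ball_iff_norm] at h
  have h1 := norm_sub_norm_le p ζ
  have h2 := norm_sub_norm_le ζ p
  rw [norm_sub_rev] at h1
  have h3 := norm_nonneg p
  have h4 := norm_nonneg (ζ - p)
  constructor <;> linarith

lemma eventually_forall_mem_ball_half {P : ℂ → Prop} (h : ∀ᶠ ζ in 𝓝[≠] (0 : ℂ), P ζ) :
    ∀ᶠ p in 𝓝[≠] (0 : ℂ), ∀ ζ ∈ Metric.ball p (‖p‖ / 2), P ζ := by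
  rw [eventually_nhdsWithin_iff, Metric.eventually_nhds_iff] at h
  obtain ⟨η, hη, h⟩ := h
  have : ∀ᶠ p in 𝓝[≠] (0 : ℂ), p ∈ Metric.ball (0 : ℂ) (η / 2) :=
    nhdsWithin_le_nhds (Metric.ball_mem_nhds _ (by linarith))
  filter_upwards [this] with p hp ζ hζ
  obtain ⟨h1, h2⟩ := norm_mem_of_mem_ball_half hζ
  have hp' : ‖p‖ < η / 2 := by simpa using hp
  refine h ?_ (norm_pos_iff.1 h1)
  rw [dist_zero_right]
  linarith

/-- A function whose weighted integral is finite near `0` is not bounded below by `c |ζ|^{-2n}` on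
half of the discs `B(p, |p|/2)` for `p → 0`. -/
lemma not_frequently_ball_half {D : ℂ → ℝ} {n : ℕ} (hn : 1 ≤ n) {r c : ℝ} (hr : 0 < r)
    (hc : 0 < c)
    (hint : ∫⁻ ζ in Metric.ball (0 : ℂ) r, ‖D ζ‖ₑ * ‖ζ‖ₑ ^ (2 * n - 2) ≠ ⊤) :
    ¬ ∃ᶠ p in 𝓝[≠] (0 : ℂ), ∃ E ⊆ Metric.ball p (‖p‖ / 2), MeasurableSet E ∧
      volume (Metric.ball p (‖p‖ / 2)) / 2 ≤ volume E ∧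
      ∀ᵐ ζ, ζ ∈ E → c ≤ |D ζ| * ‖ζ‖ ^ (2 * n) := by
  set G : ℂ → ENNReal := fun ζ => ‖D ζ‖ₑ * ‖ζ‖ₑ ^ (2 * n - 2) with hG
  have hvol : Tendsto (fun p : ℂ =>
      (volume.restrict (Metric.ball (0 : ℂ) r)) (Metric.ball p (‖p‖ / 2))) (𝓝[≠] 0) (𝓝 0) := by
    have h1 : Tendsto (fun p : ℂ => volume (Metric.ball p (‖p‖ / 2))) (𝓝[≠] 0) (𝓝 0) := by
      simp_rw [Complex.volume_ball]
      have h2 : Continuous fun p : ℂ => ENNReal.ofReal (‖p‖ / 2) ^ 2 * (NNReal.pi : ENNReal) := by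
        refine ENNReal.continuous_mul_const ENNReal.coe_ne_top |>.comp ?_
        exact (ENNReal.continuous_pow 2).comp (ENNReal.continuous_ofReal.comp (by fun_prop))
      have h3 := (h2.tendsto 0).mono_left (nhdsWithin_le_nhds (s := {0}ᶜ))
      simpa using h3
    exact tendsto_of_tendsto_of_tendsto_of_le_of_le tendsto_const_nhds h1
      (fun _ => zero_le) (fun p => Measure.restrict_apply_le _ _)
  have hlim := tendsto_setLIntegral_zero hint hvol
  set κ : ENNReal := ENNReal.ofReal (c * Real.pi / 32) with hκ
  have hκ0 : 0 < κ := by rw [hκ, ENNReal.ofReal_pos]; positivity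
  have hsmall : ∀ᶠ p in 𝓝[≠] (0 : ℂ), p ∈ Metric.ball (0 : ℂ) (r / 2) :=
    nhdsWithin_le_nhds (Metric.ball_mem_nhds _ (by linarith))
  intro hfreq
  obtain ⟨p, ⟨E, hEb, hEm, hEv, hED⟩, hpκ, hpr, hp0⟩ := (hfreq.and_eventually
    ((hlim.eventually (gt_mem_nhds hκ0)).and (hsmall.and self_mem_nhdsWithin))).exists
  have hpp : 0 < ‖p‖ := norm_pos_iff.2 hp0
  have hp' : ‖p‖ < r / 2 := by simpa using hpr
  have hsub : Metric.ball p (‖p‖ / 2) ⊆ Metric.ball 0 r := fun ζ hζ => by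
    have := (norm_mem_of_mem_ball_half hζ).2
    rw [mem_ball_zero_iff]
    linarith
  rw [Measure.restrict_restrict Metric.isOpen_ball.measurableSet,
    inter_eq_self_of_subset_left hsub] at hpκ
  refine absurd hpκ (not_lt.2 ?_)
  have hlow : ∀ᵐ ζ ∂(volume.restrict E), ENNReal.ofReal (c / (2 * ‖p‖) ^ 2) ≤ G ζ := by
    rw [ae_restrict_iff' hEm]
    filter_upwards [hED] with ζ hζ hζE
    obtain ⟨h1, h2⟩ := norm_mem_of_mem_ball_half (hEb hζE)
    have h3 := hζ hζE
    have hGeq : G ζ = ENNReal.ofReal (|D ζ| * ‖ζ‖ ^ (2 * n - 2)) := by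
      rw [hG, ENNReal.ofReal_mul (abs_nonneg _), ENNReal.ofReal_pow (norm_nonneg _), ofReal_norm,
        ← Real.norm_eq_abs, ofReal_norm]
    rw [hGeq]
    refine ENNReal.ofReal_le_ofReal ?_
    rw [div_le_iff₀ (by positivity)]
    obtain ⟨k, rfl⟩ := Nat.exists_eq_add_of_le hn
    have hk : 2 * (1 + k) - 2 = 2 * k := by omega
    have hk' : 2 * (1 + k) = 2 * k + 2 := by ring
    rw [hk]
    rw [hk', pow_add, ← mul_assoc] at h3
    refine h3.trans ?_
    gcongr
  calc κ = ENNReal.ofReal (c / (2 * ‖p‖) ^ 2) * (volume (Metric.ball p (‖p‖ / 2)) / 2) := by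
        have hpi : (NNReal.pi : ENNReal) = ENNReal.ofReal Real.pi := by
          rw [ENNReal.ofReal, ← NNReal.coe_real_pi, Real.toNNReal_coe]
        have h2 : (2 : ENNReal) = ENNReal.ofReal 2 := by simp
        rw [Complex.volume_ball, hpi, h2, ← ENNReal.ofReal_pow (by positivity),
          ← ENNReal.ofReal_mul (by positivity), ← ENNReal.ofReal_div_of_pos (by norm_num),
          ← ENNReal.ofReal_mul (by positivity), hκ]
        congr 1
        field_simp
        ring
    _ ≤ ENNReal.ofReal (c / (2 * ‖p‖) ^ 2) * volume E := by gcongr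
    _ = ∫⁻ ζ in E, ENNReal.ofReal (c / (2 * ‖p‖) ^ 2) := by rw [setLIntegral_const]
    _ ≤ ∫⁻ ζ in E, G ζ := lintegral_mono_ae hlow
    _ ≤ ∫⁻ ζ in Metric.ball p (‖p‖ / 2), G ζ := lintegral_mono_set hEb

lemma norm_pow_two_mul_eq_exp {ζ : ℂ} (hζ : ζ ≠ 0) (n : ℕ) :
    ‖ζ‖ ^ (2 * n) = Real.exp (2 * n * Real.log ‖ζ‖) := by
  have hp : 0 < ‖ζ‖ := norm_pos_iff.2 hζ
  rw [show (2 * n * Real.log ‖ζ‖ : ℝ) = ((2 * n : ℕ) : ℝ) * Real.log ‖ζ‖ by push_cast; ring,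
    Real.exp_nat_mul, Real.exp_log hp]

/-- If `u ≤ s log |ζ|` near `0` for all `s < m / C₀` with `m ≥ n`, and `χ(t) - C₀ t → -∞`, then
`e^{-2χ(u)}` dominates any function that is `O(|ζ|^{-2m})`. -/
lemma eventually_le_sub_of_forall_lt {χ : ℝ → ℝ} {C₀ : ℝ} (hC₀ : 0 < C₀)
    (hg : Tendsto (fun t => χ t - C₀ * t) atBot atBot) {n : ℕ} (hn : 1 ≤ n) {m : ℝ}
    (hm : (n : ℝ) ≤ m) {u : ℂ → EReal} {R : ℝ} (hR : 0 < R)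
    (hu : SubmeanOn u (Metric.ball 0 R))
    (hev : ∀ s < m / C₀, ∀ᶠ ζ : ℂ in 𝓝[≠] 0, u ζ ≤ ((s * Real.log ‖ζ‖ : ℝ) : EReal))
    {Y : ℂ → ℝ} {C : ℝ}
    (hY : ∀ᶠ ζ : ℂ in 𝓝[≠] 0, Y ζ ≤ Real.exp (-2 * (m * Real.log ‖ζ‖ - C))) :
    ∀ᶠ ζ : ℂ in 𝓝[≠] 0, u ζ ≠ ⊥ →
      Real.exp (2 * C) ≤ |expNegTwo (extend χ (u ζ)) - Y ζ| * ‖ζ‖ ^ (2 * n) := by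
  have hn' : (1 : ℝ) ≤ n := by exact_mod_cast hn
  have hmpos : 0 < m / C₀ := div_pos (by linarith) hC₀
  obtain ⟨C₁, hC₁⟩ := hu.exists_le_mul_log_add hR hev
  obtain ⟨T, hT⟩ := eventually_atBot.1 (hg.eventually (eventually_le_atBot (-(C₀ * C₁ + C + 1))))
  have hlogT : ∀ᶠ ζ : ℂ in 𝓝[≠] 0, m / C₀ * Real.log ‖ζ‖ + C₁ ≤ T := by
    have : Tendsto (fun ζ : ℂ => m / C₀ * Real.log ‖ζ‖ + C₁) (𝓝[≠] 0) atBot :=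
      tendsto_atBot_add_const_right _ _ (tendsto_log_norm_nhdsNE_zero.const_mul_atBot hmpos)
    exact this.eventually (eventually_le_atBot T)
  filter_upwards [hC₁, hlogT, hY, tendsto_log_norm_nhdsNE_zero.eventually (eventually_le_atBot 0),
    self_mem_nhdsWithin] with ζ h1 h2 h3 h4 h5 hbot
  rw [norm_pow_two_mul_eq_exp h5]
  set l := Real.log ‖ζ‖ with hl
  have hx : ∃ x : ℝ, u ζ = x := by
    refine ⟨(u ζ).toReal, (EReal.coe_toReal ?_ hbot).symm⟩
    exact (h1.trans_lt (EReal.coe_lt_top _)).ne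
  obtain ⟨x, hx⟩ := hx
  rw [hx] at h1 ⊢
  have h1 : x ≤ m / C₀ * l + C₁ := by exact_mod_cast h1
  rw [extend_coe, expNegTwo_coe]
  have hgx := hT x (h1.trans h2)
  have hC₀x : C₀ * x ≤ m * l + C₀ * C₁ := by
    calc C₀ * x ≤ C₀ * (m / C₀ * l + C₁) := mul_le_mul_of_nonneg_left h1 hC₀.le
      _ = _ := by field_simp
  have hX : Real.exp (-2 * (m * l - C) + 1) ≤ Real.exp (-2 * χ x) :=
    Real.exp_le_exp.2 (by linarith)
  have he : 2 * Real.exp (-2 * (m * l - C)) ≤ Real.exp (-2 * (m * l - C) + 1) := by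
    rw [Real.exp_add, mul_comm]
    exact mul_le_mul_of_nonneg_left (by linarith [Real.add_one_le_exp 1]) (Real.exp_pos _).le
  have hdiff : Real.exp (-2 * (m * l - C)) ≤ |Real.exp (-2 * χ x) - Y ζ| :=
    le_trans (by linarith) (le_abs_self _)
  calc Real.exp (2 * C) ≤ Real.exp (-2 * (m * l - C)) * Real.exp (2 * n * l) := by
        rw [← Real.exp_add]
        refine Real.exp_le_exp.2 ?_
        nlinarith
    _ ≤ _ := mul_le_mul_of_nonneg_right hdiff (Real.exp_pos _).le

/-- If the logarithmic slope of `u` at `0` is smaller than `a / C₀`, then a function bounded below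
by a multiple of `|ζ|^{-2a}` dominates `e^{-2χ(u)}` on half of suitable discs near `0`. -/
lemma frequently_ball_half_of_not_eventually {χ : ℝ → ℝ} {C₀ : ℝ} (hC₀ : 0 < C₀)
    (hχ : Monotone χ) (hχA : ∀ A, C₀ < A → ∃ K T : ℝ, ∀ t ≤ T, A * t - K ≤ χ t)
    {n : ℕ} (hn : 1 ≤ n) {a : ℝ} {u : ℂ → EReal} {R : ℝ} (hR : 0 < R)
    (hu : SubmeanOn u (Metric.ball 0 R))
    (hev : ∀ s < n / C₀, ∀ᶠ ζ : ℂ in 𝓝[≠] 0, u ζ ≤ ((s * Real.log ‖ζ‖ : ℝ) : EReal))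
    {s₀ : ℝ} (hs₀ : s₀ < a / C₀)
    (hs₀u : ¬ ∀ᶠ ζ : ℂ in 𝓝[≠] 0, u ζ ≤ ((s₀ * Real.log ‖ζ‖ : ℝ) : EReal))
    {Y : ℂ → ℝ} {C : ℝ}
    (hY : ∀ᶠ ζ : ℂ in 𝓝[≠] 0, Real.exp (-2 * (a * Real.log ‖ζ‖ + C)) ≤ Y ζ) :
    ∃ᶠ p in 𝓝[≠] (0 : ℂ), ∃ E ⊆ Metric.ball p (‖p‖ / 2), MeasurableSet E ∧
      volume (Metric.ball p (‖p‖ / 2)) / 2 ≤ volume E ∧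
      ∀ ζ ∈ E, Real.exp (-2 * C) / 2 ≤
        |expNegTwo (extend χ (u ζ)) - Y ζ| * ‖ζ‖ ^ (2 * n) := by
  have hn' : (1 : ℝ) ≤ n := by exact_mod_cast hn
  have hlog := tendsto_log_norm_nhdsNE_zero
  have hneg : ∀ᶠ ζ : ℂ in 𝓝[≠] 0, Real.log ‖ζ‖ ≤ 0 := hlog.eventually (eventually_le_atBot 0)
  set S : Set ℝ := {s | ∀ᶠ ζ : ℂ in 𝓝[≠] 0, u ζ ≤ ((s * Real.log ‖ζ‖ : ℝ) : EReal)} with hS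
  have hdown : ∀ s ∈ S, ∀ s' ≤ s, s' ∈ S := by
    intro s hs s' hss
    have hs : ∀ᶠ ζ : ℂ in 𝓝[≠] 0, u ζ ≤ ((s * Real.log ‖ζ‖ : ℝ) : EReal) := hs
    change ∀ᶠ ζ : ℂ in 𝓝[≠] 0, u ζ ≤ ((s' * Real.log ‖ζ‖ : ℝ) : EReal)
    filter_upwards [hs, hneg] with ζ h1 h2
    exact h1.trans (EReal.coe_le_coe_iff.2 (mul_le_mul_of_nonpos_right hss h2))
  have hSb : ∀ s ∈ S, s ≤ s₀ := by
    intro s hs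
    by_contra! hlt
    exact hs₀u (hdown s hs s₀ hlt.le)
  have hSne : S.Nonempty := ⟨n / C₀ - 1, hev _ (by linarith)⟩
  have hSbdd : BddAbove S := ⟨s₀, hSb⟩
  set b := sSup S with hb
  have hbs : b ≤ s₀ := csSup_le hSne hSb
  have hnb : n / C₀ ≤ b := by
    refine le_of_forall_lt fun s hs => ?_
    obtain ⟨s', h1, h2⟩ := exists_between hs
    exact h1.trans_le (le_csSup hSbdd (hev s' h2))
  have hnC : 0 < n / C₀ := div_pos (by linarith) hC₀
  have hb0 : 0 < b := hnC.trans_le hnb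
  have hba : b < a / C₀ := hbs.trans_lt hs₀
  have hna : (n : ℝ) < a := by
    have := hnb.trans_lt hba
    rwa [div_lt_div_iff_of_pos_right hC₀] at this
  set d := a / C₀ - b with hd
  have hd0 : 0 < d := sub_pos.2 hba
  obtain ⟨ε, hε0, hε⟩ : ∃ ε, 0 < ε ∧ ε < min b (d / 16) :=
    exists_between (lt_min hb0 (by linarith))
  have hεb : ε < b := hε.trans_le (min_le_left _ _)
  have hεd : ε < d / 16 := hε.trans_le (min_le_right _ _)
  set τ := b + d / 2 with hτ
  have hτ0 : 0 < τ := by linarith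
  have hτa : C₀ * τ < a := by
    have : τ < a / C₀ := by linarith
    rwa [lt_div_iff₀ hC₀, mul_comm] at this
  have hlow : b - ε ∈ S := by
    obtain ⟨s, hs, hlt⟩ := exists_lt_of_lt_csSup hSne (show b - ε < b by linarith)
    exact hdown s hs _ hlt.le
  have hhigh : ∃ᶠ p : ℂ in 𝓝[≠] 0, ¬ u p ≤ (((b + ε) * Real.log ‖p‖ : ℝ) : EReal) := by
    rw [← not_eventually]
    intro h
    have := le_csSup hSbdd (show b + ε ∈ S from h)
    linarith
  obtain ⟨A, hA1, hA2⟩ : ∃ A, C₀ < A ∧ A < a / τ :=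
    exists_between (by rwa [lt_div_iff₀ hτ0])
  have hAτ : A * τ < a := by rwa [lt_div_iff₀ hτ0] at hA2
  obtain ⟨K, T, hKT⟩ := hχA A hA1
  have hlt : ∀ {c : ℝ}, 0 < c → ∀ B : ℝ, ∀ᶠ p : ℂ in 𝓝[≠] 0, c * Real.log ‖p‖ ≤ B := by
    intro c hc B
    exact (hlog.const_mul_atBot hc).eventually (eventually_le_atBot B)
  have hballR : ∀ᶠ ζ : ℂ in 𝓝[≠] 0, ζ ∈ Metric.ball (0 : ℂ) R :=
    nhdsWithin_le_nhds (Metric.ball_mem_nhds _ hR)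
  have hlow' : ∀ᶠ ζ : ℂ in 𝓝[≠] 0, u ζ ≤ (((b - ε) * Real.log ‖ζ‖ : ℝ) : EReal) := hlow
  have hE := eventually_forall_mem_ball_half (hlow'.and (hY.and (hneg.and hballR)))
  refine (hhigh.and_eventually (hE.and
    ((hlt (c := τ - b - 3 * ε) (by linarith) (-((b - ε) * Real.log 2))).and
    ((hlt hτ0 T).and ((hlt (c := 2 * (a - A * τ)) (by linarith)
      (-(2 * a * Real.log 2 + 2 * C + 2 * K + 1))).and
    ((hlt one_pos (-1)).and self_mem_nhdsWithin)))))).mono ?_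
  rintro p ⟨hp, hball, hmk, hpT, hdom, hp1, hp0⟩
  have hpp : 0 < ‖p‖ := norm_pos_iff.2 hp0
  rw [not_le] at hp
  set l := Real.log ‖p‖ with hl
  have hlog2 : 0 < Real.log 2 := Real.log_pos (by norm_num)
  have hll : ∀ ζ ∈ Metric.ball p (‖p‖ / 2), Real.log ‖ζ‖ ≤ l + Real.log 2 := by
    intro ζ hζ
    obtain ⟨h1, h2⟩ := norm_mem_of_mem_ball_half hζ
    rw [hl, add_comm, ← Real.log_mul (by norm_num) hpp.ne']
    exact Real.log_le_log h1 h2.le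
  set B := Metric.ball p (‖p‖ / 2) with hB
  have huB : SubmeanOn u B := hu.mono fun ζ hζ => (hball ζ hζ).2.2.2
  set M := (b - ε) * (l + Real.log 2) with hM
  have hMle : ∀ ζ ∈ B, u ζ ≤ M := fun ζ hζ =>
    (hball ζ hζ).1.trans (EReal.coe_le_coe_iff.2
      (mul_le_mul_of_nonneg_left (hll ζ hζ) (by linarith)))
  have htM : τ * l < M := by
    have h1 : 0 < (b - ε) * Real.log 2 := mul_pos (by linarith) hlog2
    have h2 : 0 < (τ - b + ε) * (-l) := mul_pos (by linarith) (by linarith)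
    rw [hM]
    linarith
  have hmarkov := huB.measure_ball_le (μ := volume) measurePreserving_rotation hp.le hMle htM
  have hratio : (M - (b + ε) * l) / (M - τ * l) ≤ 1 / 2 := by
    rw [div_le_div_iff₀ (sub_pos.2 htM) (by norm_num)]
    rw [hM]
    linarith
  have hBm : MeasurableSet (B ∩ {x | u x ≤ ((τ * l : ℝ) : EReal)}) :=
    huB.measurableSet_inter_le Metric.isOpen_ball _
  have hBfin : volume B ≠ ⊤ := measure_ball_lt_top.ne
  refine ⟨B \ (B ∩ {x | u x ≤ ((τ * l : ℝ) : EReal)}), sdiff_subset,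
    Metric.isOpen_ball.measurableSet.diff hBm, ?_, ?_⟩
  · have h1 : volume (B ∩ {x | u x ≤ ((τ * l : ℝ) : EReal)}) ≤ volume B / 2 := by
      refine hmarkov.trans ?_
      rw [ENNReal.div_eq_inv_mul]
      refine mul_le_mul_left ((ENNReal.ofReal_le_ofReal hratio).trans (le_of_eq ?_)) _
      rw [one_div, ENNReal.ofReal_inv_of_pos (by norm_num)]
      simp
    rw [measure_sdiff inter_subset_left hBm.nullMeasurableSet
      (ne_top_of_le_ne_top hBfin (measure_mono inter_subset_left))]
    refine le_trans ?_ (tsub_le_tsub_left h1 _)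
    rw [ENNReal.sub_half hBfin]
  · rintro ζ ⟨hζB, hζu⟩
    obtain ⟨h1, h2, h3, -⟩ := hball ζ hζB
    have hζ0 : ζ ≠ 0 := norm_pos_iff.1 (norm_mem_of_mem_ball_half hζB).1
    have hζu : ((τ * l : ℝ) : EReal) < u ζ := by
      rw [← not_le]
      exact fun h => hζu ⟨hζB, h⟩
    obtain ⟨x, hx⟩ : ∃ x : ℝ, u ζ = x :=
      ⟨(u ζ).toReal, (EReal.coe_toReal (h1.trans_lt (EReal.coe_lt_top _)).ne
        (ne_bot_of_gt hζu)).symm⟩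
    rw [hx] at hζu ⊢
    have hζu : τ * l < x := by exact_mod_cast hζu
    rw [extend_coe, expNegTwo_coe, norm_pow_two_mul_eq_exp hζ0]
    have hl' := hll ζ hζB
    set k := Real.log ‖ζ‖ with hk
    have hχx : A * (τ * l) - K ≤ χ x := (hKT _ hpT).trans (hχ hζu.le)
    have hX : 2 * Real.exp (-2 * χ x) ≤ Real.exp (-2 * (a * k + C)) := by
      have hak : a * k ≤ a * (l + Real.log 2) := mul_le_mul_of_nonneg_left hl' (by linarith)
      calc 2 * Real.exp (-2 * χ x) ≤ Real.exp 1 * Real.exp (-2 * χ x) :=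
            mul_le_mul_of_nonneg_right (by linarith [Real.add_one_le_exp 1]) (Real.exp_pos _).le
        _ = Real.exp (1 + -2 * χ x) := (Real.exp_add _ _).symm
        _ ≤ _ := Real.exp_le_exp.2 (by linarith)
    have hdiff : Real.exp (-2 * (a * k + C)) / 2 ≤ |Real.exp (-2 * χ x) - Y ζ| := by
      rw [abs_sub_comm]
      refine le_trans ?_ (le_abs_self _)
      linarith
    calc Real.exp (-2 * C) / 2
        ≤ Real.exp (-2 * (a * k + C)) / 2 * Real.exp (2 * n * k) := by
          rw [div_mul_eq_mul_div, ← Real.exp_add]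
          refine div_le_div_of_nonneg_right (Real.exp_le_exp.2 ?_) (by norm_num)
          have := mul_nonneg (sub_nonneg.2 hna.le) (neg_nonneg.2 h3)
          linarith
      _ ≤ _ := mul_le_mul_of_nonneg_right hdiff (Real.exp_pos _).le

/-- The one-variable case, with the weight `|ζ|^{2n-2}`. -/
lemma lintegral_line_eq_top {χ : ℝ → ℝ} {C₀ : ℝ} (hC₀ : 0 < C₀)
    (hχ : Monotone χ) (hχA : ∀ A, C₀ < A → ∃ K T : ℝ, ∀ t ≤ T, A * t - K ≤ χ t)
    (hg : Tendsto (fun t => χ t - C₀ * t) atBot atBot) {n : ℕ} (hn : 1 ≤ n)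
    {u v : ℂ → EReal} {R : ℝ} (hR : 0 < R) (hu : SubmeanOn u (Metric.ball 0 R))
    (hev : ∀ s < n / C₀, ∀ᶠ ζ : ℂ in 𝓝[≠] 0, u ζ ≤ ((s * Real.log ‖ζ‖ : ℝ) : EReal))
    (hbot : ∀ᵐ ζ, ζ ∈ Metric.ball (0 : ℂ) R → u ζ ≠ ⊥)
    {D : Set ℂ} (hv : HasAnalyticSingularitiesOn v D) (hD : (0 : ℂ) ∈ D) :
    ∫⁻ ζ in Metric.ball (0 : ℂ) R,
      ‖expNegTwo (extend χ (u ζ)) - expNegTwo (v ζ)‖ₑ * ‖ζ‖ₑ ^ (2 * n - 2) = ⊤ := by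
  by_contra hint
  have hneg : ∀ᶠ ζ : ℂ in 𝓝[≠] 0, Real.log ‖ζ‖ ≤ 0 :=
    tendsto_log_norm_nhdsNE_zero.eventually (eventually_le_atBot 0)
  have hballR : ∀ᶠ ζ : ℂ in 𝓝[≠] 0, ζ ∈ Metric.ball (0 : ℂ) R :=
    nhdsWithin_le_nhds (Metric.ball_mem_nhds _ hR)
  have not_upper_bound : ∀ m : ℝ, (n : ℝ) ≤ m →
      (∀ s < m / C₀, ∀ᶠ ζ : ℂ in 𝓝[≠] 0, u ζ ≤ ((s * Real.log ‖ζ‖ : ℝ) : EReal)) →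
      ∀ C : ℝ, ¬ ∀ᶠ ζ : ℂ in 𝓝[≠] 0,
        expNegTwo (v ζ) ≤ Real.exp (-2 * (m * Real.log ‖ζ‖ - C)) := by
    intro m hm hevm C hY
    refine not_frequently_ball_half hn hR (Real.exp_pos (2 * C)) hint (Eventually.frequently ?_)
    filter_upwards [eventually_forall_mem_ball_half ((eventually_le_sub_of_forall_lt hC₀ hg hn hm
      hR hu hevm hY).and hballR)] with p hp
    refine ⟨_, subset_rfl, Metric.isOpen_ball.measurableSet, ENNReal.half_le_self, ?_⟩
    filter_upwards [hbot] with ζ hζ hζB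
    exact (hp ζ hζB).1 (hζ (hp ζ hζB).2)
  rcases hv.eventually_bot_or_log hD with hvb | ⟨a, C, hvC⟩
  · refine not_upper_bound n le_rfl hev 0 ?_
    filter_upwards [hvb] with ζ hζ
    rw [hζ, expNegTwo_bot]
    positivity
  have hup : ∀ᶠ ζ : ℂ in 𝓝[≠] 0, expNegTwo (v ζ) ≤ Real.exp (-2 * (a * Real.log ‖ζ‖ - C)) :=
    hvC.mono fun ζ h => expNegTwo_le h.1
  have hdn : ∀ᶠ ζ : ℂ in 𝓝[≠] 0, Real.exp (-2 * (a * Real.log ‖ζ‖ + C)) ≤ expNegTwo (v ζ) :=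
    hvC.mono fun ζ h => le_expNegTwo
      (ne_bot_of_gt (lt_of_lt_of_le (EReal.bot_lt_coe _) h.1)) h.2
  rcases le_or_gt a n with han | han
  · refine not_upper_bound n le_rfl hev C ?_
    filter_upwards [hup, hneg] with ζ h1 h2
    refine h1.trans (Real.exp_le_exp.2 ?_)
    nlinarith
  · by_cases hall : ∀ s < a / C₀, ∀ᶠ ζ : ℂ in 𝓝[≠] 0, u ζ ≤ ((s * Real.log ‖ζ‖ : ℝ) : EReal)
    · exact not_upper_bound a han.le hall C hup
    · push Not at hall
      obtain ⟨s₀, hs₀, hs₀u⟩ := hall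
      refine not_frequently_ball_half hn hR (c := Real.exp (-2 * C) / 2) (by positivity) hint ?_
      refine (frequently_ball_half_of_not_eventually hC₀ hχ hχA hn hR hu hev hs₀
        (by simpa using hs₀u) hdn).mono ?_
      rintro p ⟨E, h1, h2, h3, h4⟩
      exact ⟨E, h1, h2, h3, Eventually.of_forall h4⟩

lemma eventually_le_mul_log_of_le_lelongNumber {n : ℕ} {φ : Cn n → EReal} {C₀ : ℝ} (hC₀ : 0 < C₀)
    (hν : (n : EReal) ≤ (C₀ : EReal) * lelongNumber φ 0) {s : ℝ} (hs : s < n / C₀) :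
    ∀ᶠ z in 𝓝[≠] (0 : Cn n), φ z ≤ ((s * Real.log ‖z‖ : ℝ) : EReal) := by
  have hlt : (s : EReal) < lelongNumber φ 0 := by
    by_contra! hle
    have h1 : (C₀ : EReal) * lelongNumber φ 0 ≤ (C₀ : EReal) * (s : EReal) :=
      mul_le_mul_of_nonneg_left hle (by exact_mod_cast hC₀.le)
    have h2 := hν.trans h1
    rw [← EReal.coe_mul] at h2
    have h3 : (n : ℝ) ≤ C₀ * s := by exact_mod_cast h2
    rw [lt_div_iff₀ hC₀] at hs
    linarith
  have hev := eventually_lt_of_lt_liminf hlt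
  have hball : ∀ᶠ z in 𝓝[≠] (0 : Cn n), z ∈ Metric.ball (0 : Cn n) 1 :=
    nhdsWithin_le_nhds (Metric.ball_mem_nhds _ one_pos)
  filter_upwards [hev, hball, self_mem_nhdsWithin] with z h1 h2 h3
  have hlog : Real.log ‖z‖ < 0 :=
    Real.log_neg (norm_pos_iff.2 h3) (by simpa using h2)
  rw [sub_zero] at h1
  generalize φ z = x at h1 ⊢
  induction x with
  | bot => exact bot_le
  | top =>
    rw [EReal.top_div_of_neg_ne_bot (by exact_mod_cast hlog) (EReal.coe_ne_bot _)] at h1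
    simp at h1
  | coe x =>
    rw [← EReal.coe_div, EReal.coe_lt_coe_iff, lt_div_iff_of_neg hlog] at h1
    exact EReal.coe_le_coe_iff.2 h1.le

lemma eventually_line_le_mul_log {n : ℕ} {φ : Cn n → EReal} {b : ℝ}
    (h : ∀ s < b, ∀ᶠ z in 𝓝[≠] (0 : Cn n), φ z ≤ ((s * Real.log ‖z‖ : ℝ) : EReal))
    {w : Cn n} (hw : w ≠ 0) {s : ℝ} (hs : s < b) :
    ∀ᶠ ζ in 𝓝[≠] (0 : ℂ), φ (ζ • w) ≤ ((s * Real.log ‖ζ‖ : ℝ) : EReal) := by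
  obtain ⟨s', h1, h2⟩ := exists_between hs
  have hlim : Tendsto (fun ζ : ℂ => ζ • w) (𝓝[≠] 0) (𝓝[≠] 0) := by
    refine tendsto_nhdsWithin_iff.2 ⟨?_, ?_⟩
    · have hc : Continuous fun ζ : ℂ => ζ • w := by fun_prop
      simpa using (hc.tendsto 0).mono_left nhdsWithin_le_nhds
    · filter_upwards [self_mem_nhdsWithin] with ζ hζ
      exact smul_ne_zero hζ hw
  have hlog : ∀ᶠ ζ in 𝓝[≠] (0 : ℂ), (s' - s) * Real.log ‖ζ‖ ≤ -(s' * Real.log ‖w‖) :=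
    (tendsto_log_norm_nhdsNE_zero.const_mul_atBot (sub_pos.2 h1)).eventually
      (eventually_le_atBot _)
  filter_upwards [hlim.eventually (h s' h2), hlog, self_mem_nhdsWithin] with ζ h3 h4 h5
  refine h3.trans (EReal.coe_le_coe_iff.2 ?_)
  rw [norm_smul, Real.log_mul (norm_ne_zero_iff.2 h5) (norm_ne_zero_iff.2 hw)]
  linarith

/-- A complex line through the origin on which the weighted integral of `D` over a disc is finite
and which meets the null set `N` in a null set. -/
lemma exists_line_of_integrableOn {n : ℕ} (hn : 1 ≤ n) {D : Cn n → ℝ} {δ : ℝ}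
    (hD : IntegrableOn D (Metric.ball 0 δ)) {N : Set (Cn n)} (hN : volume N = 0) :
    ∃ w : Cn n, w ≠ 0 ∧ (∀ ζ ∈ Metric.ball (0 : ℂ) (δ / 2), ζ • w ∈ Metric.ball (0 : Cn n) δ) ∧
      (∀ᵐ ζ : ℂ, ζ • w ∉ N) ∧
      ∫⁻ ζ in Metric.ball (0 : ℂ) (δ / 2), ‖D (ζ • w)‖ₑ * ‖ζ‖ₑ ^ (2 * n - 2) ≠ ⊤ := by
  set B := Metric.ball (0 : Cn n) δ with hB
  have hBm : MeasurableSet B := Metric.isOpen_ball.measurableSet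
  set N' := toMeasurable volume N with hN'
  have hN'm : MeasurableSet N' := measurableSet_toMeasurable _ _
  have hN'0 : volume N' = 0 := by rw [hN', measure_toMeasurable, hN]
  set F₁ : Cn n → ENNReal := B.indicator fun z => ‖D z‖ₑ with hF₁
  set F₂ : Cn n → ENNReal := N'.indicator fun _ => ⊤ with hF₂
  have hF₁m : AEMeasurable F₁ :=
    (aemeasurable_indicator_iff hBm).2 hD.aestronglyMeasurable.enorm
  have hF₂m : Measurable F₂ := measurable_const.indicator hN'm
  have hfin : ∫⁻ z, (F₁ z + F₂ z) ≠ ⊤ := by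
    rw [lintegral_add_right _ hF₂m, hF₂, lintegral_indicator_const hN'm, hN'0, mul_zero, add_zero,
      hF₁, lintegral_indicator hBm]
    exact hD.hasFiniteIntegral.ne
  obtain ⟨w, hw1, hw2, hw⟩ := exists_line_lintegral_ne_top hn (hF₁m.add hF₂m.aemeasurable) hfin
  have hw0 : w ≠ 0 := by
    rintro rfl
    simp at hw1
    linarith
  have hmem : ∀ ζ ∈ Metric.ball (0 : ℂ) (δ / 2), ζ • w ∈ B := by
    intro ζ hζ
    have hζ : ‖ζ‖ < δ / 2 := by simpa using hζ
    rw [hB, mem_ball_zero_iff, norm_smul]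
    nlinarith [norm_nonneg ζ]
  refine ⟨w, hw0, hmem, ?_, ?_⟩
  · have hmeas : Measurable fun ζ : ℂ => F₂ (ζ • w) * ‖ζ‖ₑ ^ (2 * n - 2) := by
      have : Measurable fun ζ : ℂ => ζ • w := by fun_prop
      exact (hF₂m.comp this).mul (by fun_prop)
    have hne : ∫⁻ ζ : ℂ, F₂ (ζ • w) * ‖ζ‖ₑ ^ (2 * n - 2) ≠ ⊤ :=
      ne_top_of_le_ne_top hw (lintegral_mono fun ζ => by
        simp only [Pi.add_apply]
        gcongr
        exact le_add_self)
    have hae0 : ∀ᵐ ζ : ℂ, ζ ≠ 0 := by simp [ae_iff]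
    filter_upwards [ae_lt_top hmeas hne, hae0] with ζ h1 h2 h3
    have h4 : ζ • w ∈ N' := subset_toMeasurable _ _ h3
    rw [hF₂, indicator_of_mem h4, ENNReal.top_mul (by simp [h2])] at h1
    exact lt_irrefl _ h1
  · refine ne_top_of_le_ne_top hw ?_
    refine le_trans (le_of_eq ?_) (setLIntegral_le_lintegral (Metric.ball (0 : ℂ) (δ / 2)) _) |>.trans
      (lintegral_mono (f := fun ζ => F₁ (ζ • w) * ‖ζ‖ₑ ^ (2 * n - 2)) fun ζ => ?_)
    · refine setLIntegral_congr_fun Metric.isOpen_ball.measurableSet fun ζ hζ => ?_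
      simp only [hF₁]
      rw [indicator_of_mem (hmem ζ hζ)]
    · simp only [Pi.add_apply]
      gcongr
      exact le_self_add

end PshSing

open PshSing

theorem theorem1p3 (n : ℕ) (hn : 1 ≤ n)
    (χ : ℝ → ℝ) (hχ_convex : ConvexOn ℝ Set.univ χ) (hχ_mono : Monotone χ)
    (C₀ : ℝ) (hC₀ : 0 < C₀)
    (hχ_deriv : Filter.Tendsto (fun t : ℝ => derivWithin χ (Set.Ioi t) t) Filter.atBot (nhds C₀))
    (U : Set (PshSing.Cn n)) (hU : IsOpen U) (h0U : (0 : PshSing.Cn n) ∈ U)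
    (φ : PshSing.Cn n → EReal) (hφ : PshSing.IsPlurisubharmonicOn φ U)
    (hν : (n : EReal) ≤ (C₀ : EReal) * PshSing.lelongNumber φ 0)
    (φA : PshSing.Cn n → EReal) (hφA : PshSing.IsPlurisubharmonicOn φA Set.univ)
    (hφA_sing : PshSing.HasGenAnalyticSingularitiesOn φA Set.univ)
    (h_int : MeasureTheory.IntegrableAtFilter
      (fun z => PshSing.expNegTwo (PshSing.extend χ (φ z)) - PshSing.expNegTwo (φA z))
      (nhds 0) MeasureTheory.volume) :
    ∃ ℓ : ℝ, Filter.Tendsto (fun t : ℝ => |χ t - C₀ * t|) Filter.atBot (nhds ℓ) := by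
  rcases (monotone_sub_mul_of_tendsto_rightDeriv hχ_convex hχ_deriv).tendsto_atBot_atBot_or_nhds
    with hg | ⟨l, hl⟩
  swap
  · exact ⟨|l|, hl.abs⟩
  exfalso
  obtain ⟨s, hs, hsint⟩ := h_int
  obtain ⟨r₁, hr₁, hr₁s⟩ := Metric.mem_nhds_iff.1 hs
  obtain ⟨r₂, hr₂, hr₂U, hr₂0⟩ := hφ.exists_ball_measure_inter_bot hU h0U
  set δ := min r₁ r₂ with hδ
  have hδ0 : 0 < δ := lt_min hr₁ hr₂
  have hδ₁ : Metric.ball (0 : Cn n) δ ⊆ Metric.ball 0 r₁ := Metric.ball_subset_ball (min_le_left _ _)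
  have hδ₂ : Metric.ball (0 : Cn n) δ ⊆ Metric.ball 0 r₂ := Metric.ball_subset_ball (min_le_right _ _)
  obtain ⟨w, hw0, hwB, hwN, hwint⟩ := exists_line_of_integrableOn hn
    (hsint.mono_set (hδ₁.trans hr₁s)) hr₂0
  obtain ⟨r, hr, -, hsing⟩ := hφA_sing 0 (mem_univ _)
  have hsub : SubmeanOn (fun ζ : ℂ => φ (ζ • w)) (Metric.ball 0 (δ / 2)) :=
    (hφ.submeanOn.comp_smul w).mono fun ζ hζ => hr₂U (hδ₂ (hwB ζ hζ))
  have hA : HasAnalyticSingularitiesOn (fun ζ : ℂ => φA (ζ • w))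
      {ζ : ℂ | ζ • w ∈ Metric.ball (0 : Cn n) r} := by
    simpa only [zero_add] using hsing 0 w hw0
  refine hwint (lintegral_line_eq_top hC₀ hχ_mono
    (fun A hA => exists_mul_sub_le_of_tendsto_rightDeriv hχ_convex hχ_deriv hA) hg hn
    (half_pos hδ0) hsub
    (fun s hs => eventually_line_le_mul_log
      (fun s hs => eventually_le_mul_log_of_le_lelongNumber hC₀ hν hs) hw0 hs) ?_ hA
    (by simpa using hr))
  filter_upwards [hwN] with ζ hζ hζB hbot
  exact hζ ⟨hδ₂ (hwB ζ hζB), hbot⟩
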